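/- Let $n\ge 1$ and $\kappa\ge 0$. Let $M^n_\kappa$ be $\mathbb R^n$ if $\kappa=0$ and the unit ball $\{x\in\mathbb R^n:|x|<1\}$ if $\kappa>0$, with the Riemannian metric $g_\kappa=p_\kappa^2\,\delta_{ij}$, where $p_0\equiv 1$ and $p_\kappa(x)=\frac{2}{\kappa(1-|x|^2)}$ for $\kappa>0$ (so the sectional curvature is $-\kappa^2$). Let $dx_\kappa=p_\kappa^n\,dx$, $\nabla_\kappa u=p_\kappa^{-2}\nabla u$ and $\Delta_\kappa u=p_\kappa^{-n}\,\mathrm{div}(p_\kappa^{n-2}\nabla u)$ be its volume, gradient and Laplace–Beltrami operator. Put $\mathbf{ct}_0(t)=\frac1t$, $\mathbf{ct}_\kappa(t)=\kappa\coth(\kappa t)$ for $\kappa>0$, and $L_\kappa=(n-1)\mathbf{ct}_\kappa$. Let $\Omega\subseteq M^n_\kappa$ be open, $x_0\in\Omega$, let $\rho$ be the Riemannian distance from $x_0$, and let $I=(0,\sup_\Omega\rho)$, where $\sup_\Omega\rho\in(0,\infty]$. For a smooth function $u$ write $\nabla^{\rm rad}_\kappa u=g_\kappa(\nabla_\kappa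 u,\nabla_\kappa\rho)$ and $|\nabla_\kappa u|^2=g_\kappa(\nabla_\kappa u,\nabla_\kappa u)$. Let $v,V\colon I\to[0,\infty)$ and $H\colon I\to\mathbb R$ be smooth functions such that $H$ is $(\rho,v)$-admissible for the dual Riccati pair $(L_\kappa,V)$ on $\Omega$, that is, $$-H'(t)+\Big(L_\kappa(t)-\frac{v'(t)}{v(t)}\Big)H(t)-H(t)^2\ge V(t)\qquad\text{for all } t\in I \text{ with } v(t)\neq 0 .$$ (i) If $E_1(t)=(vH)'(t)+v(t)H(t)\,(L_\kappa(t)-2\,\mathbf{ct}_\kappa(t))\ge 0$ for all $t\in I$, then for every $u\in C_0^\infty(\Omega)$ $$\int_\Omega v(\rho)\,|\Delta_\kappa u|^2\,dx_\kappa\ \ge\ \int_\Omega v(\rho)V(\rho)\,|\nabla^{\rm rad}_\kappa u|^2\,dx_\kappa .$$ (ii) If $E_2(t)=2(vH)'(t)+v(t)H(t)\,(H(t)-2\,\mathbf{ct}_\kappa(t))\ge 0$ for all $t\in I$, then for every $u\in C_0^\infty(\Omega)$ $$\int_\Omega v(\rho)\,|\Delta_\kappa u|^2\,dx_\kappa\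 \ge\ \int_\Omega v(\rho)V(\rho)\,|\nabla_\kappa u|^2\,dx_\kappa .$$ Here the integrals of the nonnegative functions take values in $[0,\infty]$. -/

import Mathlib

open Set MeasureTheory
open scoped ContDiff

noncomputable section

namespace SpaceForm

/-- The ambient coordinate space `ℝⁿ` with its Euclidean norm. -/
abbrev E (n : ℕ) := EuclideanSpace ℝ (Fin n)

/-- The underlying set of the model space form `M^n_κ`: all of `ℝⁿ` if `κ = 0`,
the open unit ball (Poincaré ball model) if `κ > 0`. -/
def carrier (n : ℕ) (κ : ℝ) : Set (E n) :=
  if κ = 0 then univ else {x | ‖x‖ < 1}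

/-- The conformal factor `p_κ`. -/
def p {n : ℕ} (κ : ℝ) (x : E n) : ℝ :=
  if κ = 0 then 1 else 2 / (κ * (1 - ‖x‖ ^ 2))

/-- The Riemannian metric `g_κ = p_κ² δ` at the point `x`. -/
def metric {n : ℕ} (κ : ℝ) (x ξ η : E n) : ℝ :=
  p κ x ^ 2 * inner ℝ ξ η

/-- The `g_κ`-norm of a tangent vector `ξ` at `x`. -/
def tangentNorm {n : ℕ} (κ : ℝ) (x ξ : E n) : ℝ :=
  Real.sqrt (metric κ x ξ ξ)

/-- The Riemannian volume `dx_κ = p_κⁿ dx` on `M^n_κ`. -/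
def vol (n : ℕ) (κ : ℝ) : Measure (E n) :=
  (volume.restrict (carrier n κ)).withDensity (fun x => ENNReal.ofReal (p κ x ^ n))

/-- `γ` restricted to `[0,1]` is a `C¹` curve in `M^n_κ` from `x` to `y`. -/
structure IsCurve {n : ℕ} (κ : ℝ) (x y : E n) (γ : ℝ → E n) : Prop where
  contDiffOn : ContDiffOn ℝ 1 γ (Icc 0 1)
  mem_carrier : ∀ t ∈ Icc (0 : ℝ) 1, γ t ∈ carrier n κ
  source : γ 0 = x
  target : γ 1 = y

/-- The `g_κ`-length of the curve `γ` on `[0,1]`. -/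
def curveLength {n : ℕ} (κ : ℝ) (γ : ℝ → E n) : ℝ :=
  ∫ t in (0 : ℝ)..1, tangentNorm κ (γ t) (deriv γ t)

/-- The Riemannian distance `d_κ(x, y)`: the infimum of the lengths of curves from `x` to `y`. -/
def rdist {n : ℕ} (κ : ℝ) (x y : E n) : ℝ :=
  sInf (curveLength κ '' {γ | IsCurve κ x y γ})

/-- The Riemannian gradient `∇_κ u = p_κ⁻² ∇u`. -/
def grad {n : ℕ} (κ : ℝ) (u : E n → ℝ) (x : E n) : E n :=
  (p κ x ^ 2)⁻¹ • gradient u x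

/-- The Euclidean divergence of a vector field. -/
def euclDiv {n : ℕ} (F : E n → E n) (x : E n) : ℝ :=
  ∑ i, (fderiv ℝ F x (EuclideanSpace.single i 1)) i

/-- The Laplace-Beltrami operator `Δ_κ u = p_κ⁻ⁿ div (p_κⁿ⁻² ∇u)`. -/
def laplacian {n : ℕ} (κ : ℝ) (u : E n → ℝ) (x : E n) : ℝ :=
  p κ x ^ (-(n : ℤ)) * euclDiv (fun y => p κ y ^ ((n : ℤ) - 2) • gradient u y) x

/-- The radial derivative `⟨∇_κ u, ∇_κ d_{x₀}⟩` with respect to `x₀`. -/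
def radDeriv {n : ℕ} (κ : ℝ) (x₀ : E n) (u : E n → ℝ) (x : E n) : ℝ :=
  metric κ x (grad κ u x) (grad κ (rdist κ x₀) x)

/-- The function `ct_κ`: `1/t` if `κ = 0`, `κ coth (κ t)` if `κ > 0`. -/
def ct (κ t : ℝ) : ℝ :=
  if κ = 0 then 1 / t else κ * (Real.cosh (κ * t) / Real.sinh (κ * t))

/-- `L_κ = (n - 1) ct_κ`. -/
def L (n : ℕ) (κ t : ℝ) : ℝ := ((n : ℝ) - 1) * ct κ t

/-- The interval `(0, sup_Ω ρ)`, `ρ = d_κ(x₀, ·)`; the supremum may be `+∞`. -/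
def radialInterval {n : ℕ} (κ : ℝ) (Ω : Set (E n)) (x₀ : E n) : Set ℝ :=
  {t | 0 < t ∧ (t : EReal) < ⨆ x ∈ Ω, (rdist κ x₀ x : EReal)}

/-- `H` is `(ρ, v)`-admissible for the dual Riccati pair `(L_κ, V)` on `Ω`, with `ρ = d_κ(x₀, ·)`.
The weight `v` may vanish; since `v'/v` has no meaning at its zeros, the differential inequality
is required only where `v ≠ 0`. -/
structure IsDualAdmissible {n : ℕ} (κ : ℝ) (Ω : Set (E n)) (x₀ : E n) (v V H : ℝ → ℝ) : Prop where
  smooth_v : ContDiffOn ℝ ∞ v (radialInterval κ Ω x₀)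
  smooth_V : ContDiffOn ℝ ∞ V (radialInterval κ Ω x₀)
  smooth_H : ContDiffOn ℝ ∞ H (radialInterval κ Ω x₀)
  nonneg_v : ∀ t ∈ radialInterval κ Ω x₀, 0 ≤ v t
  nonneg_V : ∀ t ∈ radialInterval κ Ω x₀, 0 ≤ V t
  riccati : ∀ t ∈ radialInterval κ Ω x₀, v t ≠ 0 →
    V t ≤ -deriv H t + (L n κ t - deriv v t / v t) * H t - H t ^ 2

/-- `E₁ = (vH)' + vH (L_κ - 2 ct_κ)`. -/
def E₁ (n : ℕ) (κ : ℝ) (v H : ℝ → ℝ) (t : ℝ) : ℝ :=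
  deriv (fun s => v s * H s) t + v t * H t * (L n κ t - 2 * ct κ t)

/-- `E₂ = 2 (vH)' + vH (H - 2 ct_κ)`. -/
def E₂ (κ : ℝ) (v H : ℝ → ℝ) (t : ℝ) : ℝ :=
  2 * deriv (fun s => v s * H s) t + v t * H t * (H t - 2 * ct κ t)

/-- `u ∈ C₀^∞(Ω)`. -/
structure IsTestFunction {n : ℕ} (Ω : Set (E n)) (u : E n → ℝ) : Prop where
  smooth : ContDiff ℝ ∞ u
  hasCompactSupport : HasCompactSupport u
  tsupport_subset : tsupport u ⊆ Ω

end SpaceForm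

end

/-! The proof integrates a Rellich–Pohozaev identity and completes a square. Write `G = vH`, `u_ρ`
for the radial derivative, and `X = G(ρ)(2 u_ρ ∇u - |∇u|² ∇ρ)`. Since `sn(ρ)∇ρ` is a conformal
field, the Hessian terms in `div X` cancel, and `div X = 2G u_ρ Δu + 2(G' - ct G) u_ρ² - (G' + (n-3)
ct G)|∇u|²`, where the last coefficient is `E₁`. Expanding `v(Δu - H u_ρ)² ≥ 0` and using the
Riccati inequality multiplied by `v` gives, pointwise off the centre, `v(Δu)² - div X ≥ E₁(|∇u|² -
u_ρ²) + vV u_ρ²`. If `E₁ ≥ 0`, the first term on the right may be dropped, since `u_ρ² ≤ |∇u|²`. If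
`E₂ ≥ 0`, the Riccati inequality yields `vV ≤ E₁`, and the right side dominates `vV|∇u|²`.

It remains to show that `div X` contributes nothing, although `G` may blow up at the centre. A
cutoff in `sn(ρ)` at scale `ε` leaves the error `χ' G(2u_ρ² - |∇u|²)`. Adding `E₁ ≥ 0` to the
Riccati inequality gives `vH² ≤ (2n-4) ct G`. Hence `G ≤ 0` for `n = 1`, where the bracket is `u_ρ²`
and the error has a good sign; `G = 0` for `n = 2`; and `G ≥ 0` for `n ≥ 3`. In the last case `G
sn^(n-3)` is nondecreasing because its derivative is `sn^(n-3) E₁`, so `G = O(sn^(3-n))` near the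
centre and the integrated error is at most `O(ε²)`. Fatou's lemma then removes the cutoff.

As `ρ` is defined as an infimum of lengths, its closed form has to be established first;
`rdist_eq_modelDist` does this. The analytic core is `euclDiv_pohozaevField`, `cutoff_integrand_le`,
`exists_flux_le` and `setLIntegral_le_laplacian`. -/

noncomputable section

namespace SpaceForm

open scoped RealInnerProductSpace Topology

variable {n : ℕ} {κ : ℝ}

/-! ### Generalised sine and cosine, and the conformal factor. -/

/-- `s_κ`: `t` if `κ = 0`, `sinh (κ t) / κ` if `κ > 0`. -/
def sn (κ t : ℝ) : ℝ := if κ = 0 then t else Real.sinh (κ * t) / κ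

/-- The derivative of `s_κ`. -/
def cs (κ t : ℝ) : ℝ := if κ = 0 then 1 else Real.cosh (κ * t)

theorem hasDerivAt_sn (κ t : ℝ) : HasDerivAt (sn κ) (cs κ t) t := by
  by_cases h : κ = 0
  · have : sn κ = id := by funext s; simp [sn, h]
    rw [this]; rw [show cs κ t = 1 by simp [cs, h]]; exact hasDerivAt_id t
  · have : sn κ = fun s => Real.sinh (κ * s) / κ := by funext s; simp [sn, h]
    rw [this]
    have h1 : HasDerivAt (fun s : ℝ => κ * s) κ t := by simpa using (hasDerivAt_id t).const_mul κ
    have h2 := (h1.sinh).div_const κ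
    rwa [mul_div_assoc, div_self h, mul_one,
      show Real.cosh (κ * t) = cs κ t by simp [cs, h]] at h2

theorem contDiff_sn (κ : ℝ) : ContDiff ℝ ∞ (sn κ) := by
  by_cases h : κ = 0
  · have : sn κ = id := by funext s; simp [sn, h]
    rw [this]; exact contDiff_id
  · have : sn κ = fun s => Real.sinh (κ * s) / κ := by funext s; simp [sn, h]
    rw [this]; fun_prop

theorem contDiff_cs (κ : ℝ) : ContDiff ℝ ∞ (cs κ) := by
  by_cases h : κ = 0
  · have : cs κ = fun _ => 1 := by funext s; simp [cs, h]
    rw [this]; exact contDiff_const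
  · have : cs κ = fun s => Real.cosh (κ * s) := by funext s; simp [cs, h]
    rw [this]; fun_prop

theorem cs_pos (κ t : ℝ) : 0 < cs κ t := by
  unfold cs; split_ifs <;> [exact one_pos; exact Real.cosh_pos _]

theorem sn_pos (hκ : 0 ≤ κ) {t : ℝ} (ht : 0 < t) : 0 < sn κ t := by
  unfold sn; split_ifs with h
  · exact ht
  · have : 0 < κ := lt_of_le_of_ne hκ (Ne.symm h)
    exact div_pos (Real.sinh_pos_iff.2 (mul_pos this ht)) this

theorem ct_eq (κ t : ℝ) : ct κ t = cs κ t / sn κ t := by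
  unfold ct cs sn; split_ifs with h
  · rfl
  · rw [div_div_eq_mul_div, mul_comm, div_mul_eq_mul_div]

theorem sn_strictMono (κ : ℝ) : StrictMono (sn κ) :=
  strictMono_of_deriv_pos fun t => by rw [(hasDerivAt_sn κ t).deriv]; exact cs_pos κ t

theorem isOpen_carrier (n : ℕ) (κ : ℝ) : IsOpen (carrier n κ) := by
  unfold carrier; split_ifs
  · exact isOpen_univ
  · exact isOpen_lt continuous_norm continuous_const

theorem norm_sq_lt_one {x : E n} (h : κ ≠ 0) (hx : x ∈ carrier n κ) : ‖x‖ ^ 2 < 1 := by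
  simp only [carrier, h, if_false, mem_ofPred_eq] at hx
  nlinarith [norm_nonneg x]

theorem p_pos (hκ : 0 ≤ κ) {x : E n} (hx : x ∈ carrier n κ) : 0 < p κ x := by
  unfold p; split_ifs with h
  · exact one_pos
  · have := norm_sq_lt_one h hx
    have h2 : 0 < κ := lt_of_le_of_ne hκ (Ne.symm h)
    exact div_pos two_pos (mul_pos h2 (by linarith))

theorem contDiffAt_p {x : E n} (hx : x ∈ carrier n κ) : ContDiffAt ℝ ∞ (p κ) x := by
  by_cases h : κ = 0
  · have : (p κ : E n → ℝ) = fun _ => 1 := by funext s; simp [p, h]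
    rw [this]; exact contDiffAt_const
  · have : (p κ : E n → ℝ) = fun x => 2 / (κ * (1 - ‖x‖ ^ 2)) := by funext s; simp [p, h]
    rw [this]
    have := norm_sq_lt_one h hx
    exact contDiffAt_const.div
      (contDiffAt_const.mul (contDiffAt_const.sub (contDiff_norm_sq ℝ).contDiffAt))
      (mul_ne_zero h (by linarith))

theorem tangentNorm_eq (hκ : 0 ≤ κ) {x : E n} (hx : x ∈ carrier n κ) (ξ : E n) :
    tangentNorm κ x ξ = p κ x * ‖ξ‖ := by
  rw [tangentNorm, metric, real_inner_self_eq_norm_sq, ← mul_pow,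
    Real.sqrt_sq (mul_nonneg (p_pos hκ hx).le (norm_nonneg _))]

/-! ### The conformal radial field and the closed form of the distance. -/

/-- The conformal field `s_κ(ρ) ∇_κ ρ`, where `ρ` is the distance from `a`. -/
def field (κ : ℝ) (a x : E n) : E n :=
  if κ = 0 then x - a else
    (1 - ‖a‖ ^ 2)⁻¹ • ((1 + ‖a‖ ^ 2 - 2 * ⟪x, a⟫) • x - (1 - ‖x‖ ^ 2) • a)

/-- The Euclidean conformal factor of `field`. -/
def fieldFactor (κ : ℝ) (a x : E n) : ℝ :=
  if κ = 0 then 1 else (1 - ‖a‖ ^ 2)⁻¹ * (1 + ‖a‖ ^ 2 - 2 * ⟪x, a⟫)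

theorem contDiff_field (κ : ℝ) (a : E n) : ContDiff ℝ ∞ (field κ a) := by
  by_cases h : κ = 0
  · have : field κ a = fun x => x - a := by funext s; simp [field, h]
    rw [this]; fun_prop
  · have : field κ a = fun x => (1 - ‖a‖ ^ 2)⁻¹ •
        ((1 + ‖a‖ ^ 2 - 2 * ⟪x, a⟫) • x - (1 - ‖x‖ ^ 2) • a) := by funext s; simp [field, h]
    rw [this]
    have h2 : ContDiff ℝ ∞ (fun x : E n => ‖x‖ ^ 2) := contDiff_norm_sq ℝ
    have h3 : ContDiff ℝ ∞ (fun x : E n => (⟪x, a⟫ : ℝ)) := contDiff_id.inner ℝ contDiff_const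
    exact (((contDiff_const.sub (contDiff_const.mul h3)).smul contDiff_id).sub
      ((contDiff_const.sub h2).smul contDiff_const)).const_smul (1 - ‖a‖ ^ 2)⁻¹

/-- Only the symmetric part of the derivative is scalar; for `κ > 0` there is also an antisymmetric
part, built from `a` and `x`, which drops out of the quadratic form. -/
theorem inner_fderiv_field (κ : ℝ) (a x ξ : E n) :
    ⟪fderiv ℝ (field κ a) x ξ, ξ⟫ = fieldFactor κ a x * ‖ξ‖ ^ 2 := by
  by_cases h : κ = 0
  · have : field κ a = fun x => x - a := by funext s; simp [field, h]
    rw [this]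
    simp [fieldFactor, h, fderiv_sub_const]
  · have : field κ a = fun x => (1 - ‖a‖ ^ 2)⁻¹ •
        ((1 + ‖a‖ ^ 2 - 2 * ⟪x, a⟫) • x - (1 - ‖x‖ ^ 2) • a) := by funext s; simp [field, h]
    rw [this]
    have h2 : HasFDerivAt (fun x : E n => ‖x‖ ^ 2) _ x := (hasFDerivAt_id x).norm_sq
    have h3 : HasFDerivAt (fun x : E n => (⟪x, a⟫ : ℝ)) _ x :=
      (hasFDerivAt_id x).inner ℝ (hasFDerivAt_const a x)
    have h4 := ((((h3.const_mul 2).const_sub (1 + ‖a‖ ^ 2)).smul (hasFDerivAt_id x)).sub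
      ((h2.const_sub 1).smul_const a)).const_smul (1 - ‖a‖ ^ 2)⁻¹
    erw [HasFDerivAt.fderiv h4]
    simp [fieldFactor, h, inner_add_left, inner_smul_left]
    rw [real_inner_comm ξ a]
    ring

/-- `sinh² (κ ρ / 2)` for the distance `ρ` from `a`, in the ball model. -/
def halfSinhSq (a x : E n) : ℝ := ‖x - a‖ ^ 2 / ((1 - ‖x‖ ^ 2) * (1 - ‖a‖ ^ 2))

/-- The explicit formula for the distance. -/
def modelDist (κ : ℝ) (a x : E n) : ℝ :=
  if κ = 0 then ‖x - a‖ else 2 / κ * Real.arsinh √(halfSinhSq a x)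

theorem halfSinhSq_nonneg (h : κ ≠ 0) {a x : E n} (ha : a ∈ carrier n κ) (hx : x ∈ carrier n κ) :
    0 ≤ halfSinhSq a x := by
  have := norm_sq_lt_one h ha
  have := norm_sq_lt_one h hx
  exact div_nonneg (sq_nonneg _) (mul_nonneg (by linarith) (by linarith))

theorem halfSinhSq_pos (h : κ ≠ 0) {a x : E n} (ha : a ∈ carrier n κ) (hx : x ∈ carrier n κ)
    (hne : x ≠ a) : 0 < halfSinhSq a x := by
  have := norm_sq_lt_one h ha
  have := norm_sq_lt_one h hx
  exact div_pos (pow_pos (norm_pos_iff.2 (sub_ne_zero.2 hne)) 2)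
    (mul_pos (by linarith) (by linarith))

/-- Since `cosh(κρ) = 1 + 2 halfSinhSq`, differentiation turns this into a formula for `sn(ρ)∇ρ`,
which is where the polynomial expression for `field` comes from. -/
theorem hasFDerivAt_halfSinhSq (h : κ ≠ 0) {a x : E n} (ha : a ∈ carrier n κ)
    (hx : x ∈ carrier n κ) :
    HasFDerivAt (halfSinhSq a) ((2 / (1 - ‖x‖ ^ 2) ^ 2) • innerSL ℝ (field κ a x)) x := by
  have hA := norm_sq_lt_one h ha
  have hX := norm_sq_lt_one h hx
  have h1 : HasFDerivAt (fun x : E n => ‖x - a‖ ^ 2) _ x := ((hasFDerivAt_id x).sub_const a).norm_sq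
  have h2 : HasFDerivAt (fun x : E n => ‖x‖ ^ 2) _ x := (hasFDerivAt_id x).norm_sq
  have h3 := h1.mul ((hasDerivAt_inv (mul_ne_zero (sub_ne_zero.2 hX.ne')
    (sub_ne_zero.2 hA.ne'))).comp_hasFDerivAt x ((h2.const_sub 1).mul_const (1 - ‖a‖ ^ 2)))
  refine (HasFDerivAt.congr_fderiv h3 ?_)
  have e1 : (1 - ‖a‖ ^ 2) ≠ 0 := by linarith
  have e2 : (1 - ‖x‖ ^ 2) ≠ 0 := by linarith
  ext ξ
  simp [field, h, norm_sub_sq_real]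
  field_simp
  ring

theorem sn_modelDist (h : κ ≠ 0) {a x : E n} (ha : a ∈ carrier n κ) (hx : x ∈ carrier n κ) :
    sn κ (modelDist κ a x) = 2 / κ * √(halfSinhSq a x * (1 + halfSinhSq a x)) := by
  have hq := halfSinhSq_nonneg h ha hx
  simp only [sn, modelDist, h, if_false]
  rw [show κ * (2 / κ * Real.arsinh √(halfSinhSq a x)) = 2 * Real.arsinh √(halfSinhSq a x) by
    field_simp, Real.sinh_two_mul, Real.sinh_arsinh, Real.cosh_arsinh, Real.sq_sqrt hq,
    Real.sqrt_mul hq]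
  ring

theorem cs_modelDist (h : κ ≠ 0) {a x : E n} (ha : a ∈ carrier n κ) (hx : x ∈ carrier n κ) :
    cs κ (modelDist κ a x) = 1 + 2 * halfSinhSq a x := by
  have hq := halfSinhSq_nonneg h ha hx
  simp only [cs, modelDist, h, if_false]
  rw [show κ * (2 / κ * Real.arsinh √(halfSinhSq a x)) = 2 * Real.arsinh √(halfSinhSq a x) by
    field_simp, Real.cosh_two_mul, Real.cosh_sq, Real.sinh_arsinh, Real.sq_sqrt hq]
  ring

/-- The eikonal equation `|∇ρ| = 1`, cleared of its singularity at the centre. -/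
theorem p_sq_mul_norm_field_sq {a x : E n} (ha : a ∈ carrier n κ)
    (hx : x ∈ carrier n κ) :
    p κ x ^ 2 * ‖field κ a x‖ ^ 2 = sn κ (modelDist κ a x) ^ 2 := by
  by_cases h : κ = 0
  · simp [p, field, sn, modelDist, h]
  · have hA := norm_sq_lt_one h ha
    have hX := norm_sq_lt_one h hx
    have e1 : (1 - ‖a‖ ^ 2) ≠ 0 := by linarith
    have e2 : (1 - ‖x‖ ^ 2) ≠ 0 := by linarith
    have hq := halfSinhSq_nonneg h ha hx
    rw [sn_modelDist h ha hx, mul_pow, Real.sq_sqrt (mul_nonneg hq (by linarith))]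
    simp only [p, field, h, if_false, halfSinhSq]
    rw [norm_smul, mul_pow, norm_sub_sq_real, norm_sub_sq_real, norm_smul, norm_smul]
    simp only [inner_smul_left, inner_smul_right, mul_pow, Real.norm_eq_abs, sq_abs]
    simp
    field_simp
    ring

/-- Together with `inner_fderiv_field` this says that the Lie derivative of the metric along the
field is `2 cs(ρ)` times the metric. -/
theorem fderiv_p_field {a x : E n} (ha : a ∈ carrier n κ)
    (hx : x ∈ carrier n κ) :
    fderiv ℝ (p κ) x (field κ a x) =
      p κ x * (cs κ (modelDist κ a x) - fieldFactor κ a x) := by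
  by_cases h : κ = 0
  · have : (p κ : E n → ℝ) = fun _ => 1 := by funext s; simp [p, h]
    rw [this]
    simp [cs, fieldFactor, h]
  · have hA := norm_sq_lt_one h ha
    have hX := norm_sq_lt_one h hx
    have e1 : (1 - ‖a‖ ^ 2) ≠ 0 := by linarith
    have e2 : (1 - ‖x‖ ^ 2) ≠ 0 := by linarith
    rw [cs_modelDist h ha hx]
    have : (p κ : E n → ℝ) = fun x => 2 * (κ * (1 - ‖x‖ ^ 2))⁻¹ := by
      funext s; simp [p, h, div_eq_mul_inv]
    rw [this]
    have h2 : HasFDerivAt (fun x : E n => ‖x‖ ^ 2) _ x := (hasFDerivAt_id x).norm_sq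
    have h3 := (((hasDerivAt_inv (mul_ne_zero h e2)).comp_hasFDerivAt x
      ((h2.const_sub 1).const_mul κ))).const_mul 2
    erw [HasFDerivAt.fderiv h3]
    simp [field, fieldFactor, h, halfSinhSq, inner_sub_right, inner_smul_right, norm_sub_sq_real]
    field_simp
    ring

theorem modelDist_self (κ : ℝ) (a : E n) : modelDist κ a a = 0 := by
  simp [modelDist, halfSinhSq]

theorem modelDist_pos (hκ : 0 ≤ κ) {a x : E n} (ha : a ∈ carrier n κ) (hx : x ∈ carrier n κ)
    (hne : x ≠ a) : 0 < modelDist κ a x := by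
  unfold modelDist; split_ifs with h
  · exact norm_pos_iff.2 (sub_ne_zero.2 hne)
  · have : 0 < κ := lt_of_le_of_ne hκ (Ne.symm h)
    exact mul_pos (by positivity)
      (Real.arsinh_pos_iff.2 (Real.sqrt_pos.2 (halfSinhSq_pos h ha hx hne)))

theorem contDiffAt_halfSinhSq (h : κ ≠ 0) {a x : E n} (ha : a ∈ carrier n κ)
    (hx : x ∈ carrier n κ) : ContDiffAt ℝ ∞ (halfSinhSq a) x := by
  have hA := norm_sq_lt_one h ha
  have hX := norm_sq_lt_one h hx
  exact ((contDiff_norm_sq ℝ).comp (contDiff_id.sub contDiff_const)).contDiffAt.div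
    ((contDiffAt_const.sub (contDiff_norm_sq ℝ).contDiffAt).mul contDiffAt_const)
    (mul_ne_zero (by linarith) (by linarith))

theorem continuousAt_modelDist {a x : E n} (ha : a ∈ carrier n κ)
    (hx : x ∈ carrier n κ) : ContinuousAt (modelDist κ a) x := by
  by_cases h : κ = 0
  · have : modelDist κ a = fun x => ‖x - a‖ := by funext s; simp [modelDist, h]
    rw [this]; fun_prop
  · have : modelDist κ a = fun x => 2 / κ * Real.arsinh √(halfSinhSq a x) := by
      funext s; simp [modelDist, h]
    rw [this]
    have h1 := (contDiffAt_halfSinhSq h ha hx).continuousAt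
    exact continuousAt_const.mul (Real.continuous_arsinh.continuousAt.comp h1.sqrt)

theorem contDiffAt_modelDist {a x : E n} (ha : a ∈ carrier n κ)
    (hx : x ∈ carrier n κ) (hne : x ≠ a) : ContDiffAt ℝ ∞ (modelDist κ a) x := by
  by_cases h : κ = 0
  · have : modelDist κ a = fun x => ‖x - a‖ := by funext s; simp [modelDist, h]
    rw [this]
    exact (contDiffAt_id.sub contDiffAt_const).norm ℝ (sub_ne_zero.2 hne)
  · have : modelDist κ a = fun x => 2 / κ * Real.arsinh √(halfSinhSq a x) := by
      funext s; simp [modelDist, h]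
    rw [this]
    have h1 := contDiffAt_halfSinhSq h ha hx
    exact contDiffAt_const.mul (Real.contDiff_arsinh.contDiffAt.comp x
      (h1.sqrt (halfSinhSq_pos h ha hx hne).ne'))

theorem hasFDerivAt_modelDist (hκ : 0 ≤ κ) {a x : E n} (ha : a ∈ carrier n κ)
    (hx : x ∈ carrier n κ) (hne : x ≠ a) :
    HasFDerivAt (modelDist κ a)
      ((p κ x ^ 2 / sn κ (modelDist κ a x)) • innerSL ℝ (field κ a x)) x := by
  by_cases h : κ = 0
  · have : modelDist κ a = fun x => ‖x - a‖ := by funext s; simp [modelDist, h]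
    have h0 : ‖x - a‖ ≠ 0 := norm_ne_zero_iff.2 (sub_ne_zero.2 hne)
    have h1 : HasFDerivAt (fun x : E n => ‖x - a‖ ^ 2) _ x :=
      ((hasFDerivAt_id x).sub_const a).norm_sq
    have h2 := h1.sqrt (pow_ne_zero 2 h0)
    simp only [Real.sqrt_sq (norm_nonneg _)] at h2
    rw [this]
    refine h2.congr_fderiv ?_
    ext ξ
    simp [p, sn, field, h]
    field_simp
  · have : modelDist κ a = fun x => 2 / κ * Real.arsinh √(halfSinhSq a x) := by
      funext s; simp [modelDist, h]
    have hq := halfSinhSq_pos h ha hx hne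
    have hX := norm_sq_lt_one h hx
    have e2 : (1 - ‖x‖ ^ 2) ≠ 0 := by linarith
    have hκ0 : 0 < κ := lt_of_le_of_ne hκ (Ne.symm h)
    rw [sn_modelDist h ha hx, this]
    refine ((((hasFDerivAt_halfSinhSq h ha hx).sqrt hq.ne').arsinh).const_mul (2 / κ)).congr_fderiv ?_
    rw [Real.sq_sqrt hq.le, Real.sqrt_mul hq.le]
    have e3 : √(halfSinhSq a x) ≠ 0 := (Real.sqrt_pos.2 hq).ne'
    have e4 : √(1 + halfSinhSq a x) ≠ 0 := (Real.sqrt_pos.2 (by linarith)).ne'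
    ext ξ
    simp [p, h]
    field_simp

/-! ### Lower bound for the length of curves. -/

theorem IsCurve.integrableOn_speed (hκ : 0 ≤ κ) {x y : E n} {γ : ℝ → E n}
    (hγ : IsCurve κ x y γ) :
    IntegrableOn (fun t => tangentNorm κ (γ t) (deriv γ t)) (Icc 0 1) := by
  have hp : ContinuousOn (fun t => p κ (γ t)) (Icc 0 1) := fun t ht =>
    (contDiffAt_p (hγ.mem_carrier t ht)).continuousAt.comp_continuousWithinAt
      (hγ.contDiffOn.continuousOn t ht)
  have hd : ContinuousOn (derivWithin γ (Icc 0 1)) (Icc 0 1) :=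
    hγ.contDiffOn.continuousOn_derivWithin (uniqueDiffOn_Icc one_pos) le_rfl
  have h1 : IntegrableOn (fun t => p κ (γ t) * ‖derivWithin γ (Icc 0 1) t‖) (Icc 0 1) :=
    (hp.mul hd.norm).integrableOn_Icc
  -- The curve is `C¹` only on the closed interval, so `deriv γ` may be a junk value at the
  -- endpoints; they form a null set.
  rw [integrableOn_Icc_iff_integrableOn_Ioo] at h1 ⊢
  refine h1.congr_fun (fun t ht => ?_) measurableSet_Ioo
  dsimp only
  rw [tangentNorm_eq hκ (hγ.mem_carrier t (Ioo_subset_Icc_self ht)),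
    derivWithin_of_mem_nhds (Icc_mem_nhds ht.1 ht.2)]

theorem IsCurve.hasDerivAt {x y : E n} {γ : ℝ → E n}
    (hγ : IsCurve κ x y γ) {t : ℝ} (ht : t ∈ Ioo (0 : ℝ) 1) :
    HasDerivAt γ (deriv γ t) t :=
  (((hγ.contDiffOn t (Ioo_subset_Icc_self ht)).differentiableWithinAt one_ne_zero).differentiableAt
    (Icc_mem_nhds ht.1 ht.2)).hasDerivAt

/-- A function whose `g_κ`-gradient has norm at most `1` is `1`-Lipschitz along curves. -/
theorem sub_le_curveLength (hκ : 0 ≤ κ) {x y : E n} {γ : ℝ → E n} (hγ : IsCurve κ x y γ)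
    {D : E n → ℝ} {D' : E n → E n →L[ℝ] ℝ} (hD : ∀ z ∈ carrier n κ, HasFDerivAt D (D' z) z)
    (hle : ∀ z ∈ carrier n κ, ∀ ξ, D' z ξ ≤ p κ z * ‖ξ‖) :
    D y - D x ≤ curveLength κ γ := by
  have := intervalIntegral.sub_le_integral_of_hasDeriv_right_of_le (a := 0) (b := 1)
    (g := fun t => D (γ t)) (g' := fun t => D' (γ t) (deriv γ t))
    (φ := fun t => tangentNorm κ (γ t) (deriv γ t)) zero_le_one
    (fun t ht => (hD _ (hγ.mem_carrier t ht)).continuousAt.comp_continuousWithinAt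
      (hγ.contDiffOn.continuousOn t ht))
    (fun t ht => ((hD _ (hγ.mem_carrier t (Ioo_subset_Icc_self ht))).comp_hasDerivAt t
      (hγ.hasDerivAt ht)).hasDerivWithinAt)
    (IsCurve.integrableOn_speed hκ hγ)
    (fun t ht => by
      have hm := hγ.mem_carrier t (Ioo_subset_Icc_self ht)
      rw [tangentNorm_eq hκ hm]; exact hle _ hm _)
  simpa only [curveLength, hγ.source, hγ.target] using this

/-- The model distance is `1`-Lipschitz but not differentiable at `a`, so smooth substitutes are
used: for `κ = 0` the linear functional in the direction `x - a`, for `κ > 0` the distance with `δ`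
added under the root, after which `δ` tends to `0`. -/
theorem modelDist_le_curveLength (hκ : 0 ≤ κ) {a x : E n} (ha : a ∈ carrier n κ)
    {γ : ℝ → E n} (hγ : IsCurve κ a x γ) :
    modelDist κ a x ≤ curveLength κ γ := by
  by_cases h : κ = 0
  · have h1 := sub_le_curveLength hκ hγ (D := innerSL ℝ (‖x - a‖⁻¹ • (x - a)))
      (fun z _ => ContinuousLinearMap.hasFDerivAt _) (fun z _ ξ => by
        simp only [p, h, if_true, one_mul]
        refine (real_inner_le_norm (‖x - a‖⁻¹ • (x - a)) ξ).trans ?_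
        rw [norm_smul, norm_inv, norm_norm]
        exact mul_le_of_le_one_left (norm_nonneg _) inv_mul_le_one)
    rw [← map_sub] at h1
    refine le_trans (le_of_eq ?_) h1
    by_cases h0 : ‖x - a‖ = 0
    · simp [modelDist, h, norm_eq_zero.1 h0]
    · simp only [modelDist, h, if_true, innerSL_apply_apply, inner_smul_left,
        real_inner_self_eq_norm_sq]
      simp
      field_simp
  · have hκ0 : 0 < κ := lt_of_le_of_ne hκ (Ne.symm h)
    have key : ∀ δ > 0, 2 / κ * Real.arsinh √(halfSinhSq a x + δ)
        - 2 / κ * Real.arsinh √(halfSinhSq a a + δ) ≤ curveLength κ γ := by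
      intro δ hδ
      refine sub_le_curveLength hκ hγ (D := fun z => 2 / κ * Real.arsinh √(halfSinhSq a z + δ))
        (fun z hz => ((((hasFDerivAt_halfSinhSq h ha hz).add_const δ).sqrt
          (by have := halfSinhSq_nonneg h ha hz; positivity)).arsinh).const_mul (2 / κ)) ?_
      intro z hz ξ
      have hq := halfSinhSq_nonneg h ha hz
      have hZ := norm_sq_lt_one h hz
      have e2 : 0 < (1 - ‖z‖ ^ 2) := by linarith
      have hn : ‖field κ a z‖ =
          (1 - ‖z‖ ^ 2) * √(halfSinhSq a z * (1 + halfSinhSq a z)) := by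
        have h1 := p_sq_mul_norm_field_sq ha hz
        rw [sn_modelDist h ha hz] at h1
        rw [← mul_pow, sq_eq_sq₀ (mul_nonneg (p_pos hκ hz).le (norm_nonneg _))
          (by positivity)] at h1
        simp only [p, h, if_false] at h1
        field_simp at h1
        linarith
      have hin : ⟪field κ a z, ξ⟫ ≤ ‖field κ a z‖ * ‖ξ‖ := real_inner_le_norm _ _
      rw [Real.sq_sqrt (by positivity)]
      set q := halfSinhSq a z with hqdef
      -- Adding `δ` only enlarges the denominator of the gradient, so the Lipschitz constant `1`
      -- survives.
      have hs : √(q * (1 + q)) ≤ √(1 + (q + δ)) * √(q + δ) := by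
        rw [← Real.sqrt_mul (by positivity)]
        apply Real.sqrt_le_sqrt
        nlinarith
      have e5 : 0 < √(q + δ) := Real.sqrt_pos.2 (by positivity)
      have e6 : 0 < √(1 + (q + δ)) := Real.sqrt_pos.2 (by positivity)
      simp only [smul_apply, innerSL_apply_apply, smul_eq_mul, p, h, if_false]
      calc _ = 2 / (κ * (1 - ‖z‖ ^ 2)^2) * (√(1 + (q + δ)) * √(q + δ))⁻¹ * ⟪field κ a z, ξ⟫ := by
            field_simp
        _ ≤ 2 / (κ * (1 - ‖z‖ ^ 2)^2) * (√(1 + (q + δ)) * √(q + δ))⁻¹ *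
            ((1 - ‖z‖ ^ 2) * (√(1 + (q + δ)) * √(q + δ)) * ‖ξ‖) := by
            gcongr
            refine hin.trans ?_
            rw [hn]
            gcongr
        _ = _ := by field_simp
    have h0 : halfSinhSq a a = 0 := by simp [halfSinhSq]
    have ht : Filter.Tendsto (fun δ : ℝ => 2 / κ * Real.arsinh √(halfSinhSq a x + δ)
        - 2 / κ * Real.arsinh √(halfSinhSq a a + δ)) (nhdsWithin 0 (Ioi 0))
        (nhds (2 / κ * Real.arsinh √(halfSinhSq a x + 0)
        - 2 / κ * Real.arsinh √(halfSinhSq a a + 0))) := by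
      apply Filter.Tendsto.mono_left _ nhdsWithin_le_nhds
      have : Continuous (fun δ : ℝ => 2 / κ * Real.arsinh √(halfSinhSq a x + δ)
        - 2 / κ * Real.arsinh √(halfSinhSq a a + δ)) :=
        (continuous_const.mul (Real.continuous_arsinh.comp (by fun_prop))).sub
          (continuous_const.mul (Real.continuous_arsinh.comp (by fun_prop)))
      exact this.tendsto 0
    have := le_of_tendsto ht (Filter.eventually_of_mem self_mem_nhdsWithin key)
    simpa [modelDist, h, h0] using this

/-! ### Möbius translations and minimizing radial curves. -/

/-- The isometry of the ball model taking `0` to `a`. -/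
def mobius (a y : E n) : E n :=
  (1 + 2 * ⟪y, a⟫ + ‖a‖ ^ 2 * ‖y‖ ^ 2)⁻¹ •
    ((1 - ‖a‖ ^ 2) • y + (1 + 2 * ⟪y, a⟫ + ‖y‖ ^ 2) • a)

theorem mobius_denom_pos {a y : E n} (ha : ‖a‖ < 1) (hy : ‖y‖ < 1) :
    0 < 1 + 2 * ⟪y, a⟫ + ‖a‖ ^ 2 * ‖y‖ ^ 2 := by
  have h1 := (abs_le.1 (abs_real_inner_le_norm y a)).1
  have h2 : ‖y‖ * ‖a‖ < 1 := by nlinarith [norm_nonneg a, norm_nonneg y]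
  nlinarith [mul_pos (sub_pos.2 h2) (sub_pos.2 h2)]

theorem one_sub_norm_mobius_sq {a y : E n} (ha : ‖a‖ < 1) (hy : ‖y‖ < 1) :
    1 - ‖mobius a y‖ ^ 2 =
      (1 - ‖a‖ ^ 2) * (1 - ‖y‖ ^ 2) / (1 + 2 * ⟪y, a⟫ + ‖a‖ ^ 2 * ‖y‖ ^ 2) := by
  have hD := (mobius_denom_pos ha hy).ne'
  rw [mobius, norm_smul, mul_pow, norm_add_sq_real, norm_smul, norm_smul]
  simp only [inner_smul_left, inner_smul_right, mul_pow, Real.norm_eq_abs, sq_abs]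
  simp
  field_simp
  ring

theorem norm_mobius_lt_one {a y : E n} (ha : ‖a‖ < 1) (hy : ‖y‖ < 1) : ‖mobius a y‖ < 1 := by
  have h1 := one_sub_norm_mobius_sq ha hy
  have h2 : 0 < (1 - ‖a‖ ^ 2) * (1 - ‖y‖ ^ 2) / (1 + 2 * ⟪y, a⟫ + ‖a‖ ^ 2 * ‖y‖ ^ 2) :=
    div_pos (mul_pos (by nlinarith [norm_nonneg a]) (by nlinarith [norm_nonneg y]))
      (mobius_denom_pos ha hy)
  nlinarith [norm_nonneg (mobius a y)]

theorem inner_mobius {a y : E n} : ⟪mobius a y, a⟫ =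
    (1 + 2 * ⟪y, a⟫ + ‖a‖ ^ 2 * ‖y‖ ^ 2)⁻¹ *
    ((1 - ‖a‖ ^ 2) * ⟪y, a⟫ + (1 + 2 * ⟪y, a⟫ + ‖y‖ ^ 2) * ‖a‖ ^ 2) := by
  simp [mobius, inner_smul_left, inner_add_left]
  ring

/-- This makes `mobius (-a) x` a preimage of `x`, so that the image of the ray through it is a curve
from `a` to `x`. -/
theorem mobius_mobius_neg {a x : E n} (ha : ‖a‖ < 1) (hx : ‖x‖ < 1) :
    mobius a (mobius (-a) x) = x := by
  have ha' : ‖-a‖ < 1 := by rwa [norm_neg]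
  have hN := one_sub_norm_mobius_sq ha' hx
  have hI := inner_mobius (a := -a) (y := x)
  have hD := (mobius_denom_pos ha' hx).ne'
  have hA : 1 - ‖a‖ ^ 2 ≠ 0 := by nlinarith [norm_nonneg a]
  have hm : mobius (-a) x = _ := mobius.eq_1 (-a) x
  simp only [norm_neg] at hD hN hI hm
  have hI' : ⟪mobius (-a) x, a⟫ = -⟪mobius (-a) x, -a⟫ := by rw [inner_neg_right, neg_neg]
  rw [hI] at hI'
  generalize ⟪x, -a⟫ = b at *
  have hN' : ‖mobius (-a) x‖ ^ 2 = 1 - (1 - ‖a‖ ^ 2) * (1 - ‖x‖ ^ 2) /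
    (1 + 2 * b + ‖a‖ ^ 2 * ‖x‖ ^ 2) := by linarith
  have hden : 1 + 2 * ⟪mobius (-a) x, a⟫ + ‖a‖ ^ 2 * ‖mobius (-a) x‖ ^ 2 =
      (1 - ‖a‖ ^ 2) ^ 2 / (1 + 2 * b + ‖a‖ ^ 2 * ‖x‖ ^ 2) := by
    rw [hN', hI']; field_simp; ring
  have hnum : 1 + 2 * ⟪mobius (-a) x, a⟫ + ‖mobius (-a) x‖ ^ 2 =
      (1 - ‖a‖ ^ 2) * (1 + 2 * b + ‖x‖ ^ 2) / (1 + 2 * b + ‖a‖ ^ 2 * ‖x‖ ^ 2) := by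
    rw [hN', hI']; field_simp; ring
  rw [mobius, hden, hnum, hm]
  match_scalars
  · field_simp
  · field_simp
    ring

theorem mobius_zero (a : E n) : mobius a 0 = a := by simp [mobius]

theorem mobius_neg_self (a : E n) : mobius (-a) a = 0 := by
  rw [mobius, norm_neg, inner_neg_right, real_inner_self_eq_norm_sq]
  match_scalars
  ring

/-- On the ball, `field κ 0` is the identity field, to which rays from `0` are tangent; the isometry
carries it to `field κ a`. -/
theorem smul_deriv_mobius_ray {a y : E n} (ha : ‖a‖ < 1) {t : ℝ} (hy : ‖t • y‖ < 1) (h : κ ≠ 0) :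
    ContDiffAt ℝ ∞ (fun s : ℝ => mobius a (s • y)) t ∧
    t • deriv (fun s : ℝ => mobius a (s • y)) t = field κ a (mobius a (t • y)) := by
  have hD := mobius_denom_pos ha hy
  have hN := one_sub_norm_mobius_sq ha hy
  have hI := inner_mobius (a := a) (y := t • y)
  have hA : 1 - ‖a‖ ^ 2 ≠ 0 := by nlinarith [norm_nonneg a]
  have hf : ∀ s : ℝ, mobius a (s • y) = (1 + 2 * (s * ⟪y, a⟫) + ‖a‖ ^ 2 * (s ^ 2 * ‖y‖ ^ 2))⁻¹ •
      (((1 - ‖a‖ ^ 2) * s) • y + (1 + 2 * (s * ⟪y, a⟫) + s ^ 2 * ‖y‖ ^ 2) • a) := by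
    intro s
    simp only [mobius, inner_smul_left, norm_smul, mul_pow, Real.norm_eq_abs, sq_abs, smul_smul,
      RCLike.conj_to_real]
  simp only [inner_smul_left, norm_smul, mul_pow, Real.norm_eq_abs, sq_abs,
      RCLike.conj_to_real] at hD hN hI
  simp only [field, h, if_false]
  rw [hI, hN, hf, funext hf]
  clear hf hI hN
  set b := ⟪y, a⟫
  set A := ‖a‖ ^ 2
  set Y := ‖y‖ ^ 2
  refine ⟨?_, ?_⟩
  · refine ContDiffAt.smul (f := fun s : ℝ => (1 + 2 * (s * b) + A * (s ^ 2 * Y))⁻¹)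
      (ContDiffAt.inv (by fun_prop) hD.ne') (by fun_prop)
  · have d1 : HasDerivAt (fun s : ℝ => 1 + 2 * (s * b) + A * (s ^ 2 * Y))
        (2 * b + A * (2 * t * Y)) t := by
      have h1 := (((hasDerivAt_id t).mul_const b).const_mul 2).const_add 1
      have h2 := ((((hasDerivAt_id t).pow 2)).mul_const Y).const_mul A
      refine (h1.add h2).congr_deriv ?_
      simp
    have d2 : HasDerivAt (fun s : ℝ => 1 + 2 * (s * b) + s ^ 2 * Y)
        (2 * b + 2 * t * Y) t := by
      have h1 := (((hasDerivAt_id t).mul_const b).const_mul 2).const_add 1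
      have h2 := ((((hasDerivAt_id t).pow 2)).mul_const Y)
      refine (h1.add h2).congr_deriv ?_
      simp
    have d3 : HasDerivAt (fun s : ℝ => (1 - A) * s) (1 - A) t := by
      simpa using (hasDerivAt_id t).const_mul (1 - A)
    have d4 := (d1.inv hD.ne').smul ((d3.smul_const y).add (d2.smul_const a))
    erw [d4.deriv]
    have hD' := hD.ne'
    simp only [Pi.add_apply, Pi.inv_apply]
    generalize hDe : 1 + 2 * (t * b) + A * (t ^ 2 * Y) = D at hD' ⊢
    match_scalars
    · field_simp
      rw [← hDe]
      ring
    · field_simp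
      rw [← hDe]
      ring

/-- A curve issuing from `a` and tangent to the outward radial direction minimizes length. -/
theorem curveLength_radial (hκ : 0 ≤ κ) {a x : E n} (ha : a ∈ carrier n κ)
    {γ : ℝ → E n} (hγ : IsCurve κ a x γ) (hne : ∀ t ∈ Ioo (0 : ℝ) 1, γ t ≠ a)
    (hrad : ∀ t ∈ Ioo (0 : ℝ) 1, t • deriv γ t = field κ a (γ t)) :
    curveLength κ γ = modelDist κ a x := by
  -- Along a radial curve Cauchy–Schwarz is an equality, so the model distance grows at exactly the
  -- speed of the curve. Continuity suffices at `t = 0`, where the distance is not differentiable.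
  have hsub := intervalIntegral.integral_eq_sub_of_hasDerivAt_of_le (a := 0) (b := 1) zero_le_one
    (f := fun t => modelDist κ a (γ t)) (f' := fun t => tangentNorm κ (γ t) (deriv γ t))
    (fun t ht => (continuousAt_modelDist ha (hγ.mem_carrier t ht)).comp_continuousWithinAt
      (hγ.contDiffOn.continuousOn t ht))
    (fun t ht => by
      have hm := hγ.mem_carrier t (Ioo_subset_Icc_self ht)
      refine ((hasFDerivAt_modelDist hκ ha hm (hne t ht)).comp_hasDerivAt t
        (hγ.hasDerivAt ht)).congr_deriv ?_
      have h1 := p_sq_mul_norm_field_sq ha hm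
      have hs := sn_pos hκ (modelDist_pos hκ ha hm (hne t ht))
      have hp := p_pos hκ hm
      rw [← mul_pow, sq_eq_sq₀ (by positivity) hs.le] at h1
      rw [tangentNorm_eq hκ hm, ← h1]
      have hW : ‖field κ a (γ t)‖ = t * ‖deriv γ t‖ := by
        rw [← hrad t ht, norm_smul, Real.norm_of_nonneg ht.1.le]
      rw [hW] at h1
      have ht0 := ht.1
      have hd : 0 < ‖deriv γ t‖ := by
        rcases (norm_nonneg (deriv γ t)).eq_or_lt with h0 | h0
        · rw [← h0] at h1; simp at h1; exact absurd h1 hs.ne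
        · exact h0
      rw [hW]
      simp only [smul_apply, innerSL_apply_apply, smul_eq_mul]
      rw [← hrad t ht, inner_smul_left, real_inner_self_eq_norm_sq]
      simp
      field_simp)
    ((intervalIntegrable_iff_integrableOn_Icc_of_le zero_le_one).2
      (IsCurve.integrableOn_speed hκ hγ))
  rw [curveLength, hsub, hγ.source, hγ.target, modelDist_self, sub_zero]

theorem exists_curveLength_eq (hκ : 0 ≤ κ) {a x : E n} (ha : a ∈ carrier n κ)
    (hx : x ∈ carrier n κ) : ∃ γ, IsCurve κ a x γ ∧ curveLength κ γ = modelDist κ a x := by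
  by_cases hxa : x = a
  · subst hxa
    exact ⟨fun _ => x, ⟨contDiffOn_const, fun _ _ => hx, rfl, rfl⟩, by
      simp [curveLength, tangentNorm, metric, modelDist_self]⟩
  by_cases h : κ = 0
  · have hd : ∀ t : ℝ, HasDerivAt (fun t : ℝ => a + t • (x - a)) (x - a) t := fun t => by
      simpa using ((hasDerivAt_id t).smul_const (x - a)).const_add a
    have hγ : IsCurve κ a x (fun t : ℝ => a + t • (x - a)) :=
      ⟨by fun_prop, fun t _ => by simp [carrier, h], by simp, by simp⟩
    refine ⟨_, hγ, curveLength_radial hκ ha hγ (fun t ht => ?_) (fun t ht => ?_)⟩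
    · simp [ht.1.ne', sub_ne_zero.2 hxa]
    · rw [(hd t).deriv]; simp [field, h]
  · have ha' : ‖a‖ < 1 := by simpa [carrier, h] using ha
    have hx' : ‖x‖ < 1 := by simpa [carrier, h] using hx
    have hna : ‖-a‖ < 1 := by rwa [norm_neg]
    set y := mobius (-a) x with hy
    have hy1 : ‖y‖ < 1 := norm_mobius_lt_one hna hx'
    have hy0 : y ≠ 0 := fun h0 => hxa (by
      rw [← mobius_mobius_neg ha' hx', ← hy, h0, mobius_zero])
    have hty : ∀ t ∈ Icc (0 : ℝ) 1, ‖t • y‖ < 1 := fun t ht => by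
      rw [norm_smul, Real.norm_of_nonneg ht.1]
      exact (mul_le_of_le_one_left (norm_nonneg _) ht.2).trans_lt hy1
    have hγ : IsCurve κ a x (fun t : ℝ => mobius a (t • y)) := by
      refine ⟨fun t ht => ?_, fun t ht => ?_, by simp [mobius_zero], ?_⟩
      · exact ((smul_deriv_mobius_ray ha' (hty t ht) h).1.of_le (by simp)).contDiffWithinAt
      · simpa [carrier, h] using norm_mobius_lt_one ha' (hty t ht)
      · simpa using mobius_mobius_neg ha' hx'
    refine ⟨_, hγ, curveLength_radial hκ ha hγ (fun t ht h0 => ?_) (fun t ht => ?_)⟩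
    · have h1 := mobius_mobius_neg hna (hty t (Ioo_subset_Icc_self ht))
      rw [neg_neg, h0, mobius_neg_self] at h1
      rcases smul_eq_zero.1 h1.symm with h2 | h2
      · exact ht.1.ne' h2
      · exact hy0 h2
    · exact (smul_deriv_mobius_ray ha' (hty t (Ioo_subset_Icc_self ht)) h).2

/-! ### The Riemannian distance equals the model distance. -/

theorem rdist_eq_modelDist (hκ : 0 ≤ κ) {a x : E n} (ha : a ∈ carrier n κ)
    (hx : x ∈ carrier n κ) : rdist κ a x = modelDist κ a x := by
  obtain ⟨γ, hγ, hl⟩ := exists_curveLength_eq hκ ha hx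
  refine le_antisymm ?_ (le_csInf ⟨_, γ, hγ, rfl⟩ ?_)
  · rw [← hl]
    refine csInf_le ⟨modelDist κ a x, ?_⟩ ⟨γ, hγ, rfl⟩
    rintro _ ⟨γ', hγ', rfl⟩
    exact modelDist_le_curveLength hκ ha hγ'
  · rintro _ ⟨γ', hγ', rfl⟩
    exact modelDist_le_curveLength hκ ha hγ'

theorem rdist_eventuallyEq (hκ : 0 ≤ κ) {a x : E n} (ha : a ∈ carrier n κ)
    (hx : x ∈ carrier n κ) : rdist κ a =ᶠ[nhds x] modelDist κ a :=
  Filter.eventually_of_mem ((isOpen_carrier n κ).mem_nhds hx)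
    fun _ hy => rdist_eq_modelDist hκ ha hy

theorem rdist_pos (hκ : 0 ≤ κ) {a x : E n} (ha : a ∈ carrier n κ) (hx : x ∈ carrier n κ)
    (hne : x ≠ a) : 0 < rdist κ a x := by
  rw [rdist_eq_modelDist hκ ha hx]; exact modelDist_pos hκ ha hx hne

theorem rdist_self (hκ : 0 ≤ κ) {a : E n} (ha : a ∈ carrier n κ) : rdist κ a a = 0 := by
  rw [rdist_eq_modelDist hκ ha ha, modelDist_self]

theorem continuousAt_rdist (hκ : 0 ≤ κ) {a x : E n} (ha : a ∈ carrier n κ)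
    (hx : x ∈ carrier n κ) : ContinuousAt (rdist κ a) x :=
  (continuousAt_modelDist ha hx).congr (rdist_eventuallyEq hκ ha hx).symm

theorem contDiffAt_rdist (hκ : 0 ≤ κ) {a x : E n} (ha : a ∈ carrier n κ)
    (hx : x ∈ carrier n κ) (hne : x ≠ a) : ContDiffAt ℝ ∞ (rdist κ a) x :=
  (contDiffAt_modelDist ha hx hne).congr_of_eventuallyEq (rdist_eventuallyEq hκ ha hx)

theorem hasFDerivAt_rdist (hκ : 0 ≤ κ) {a x : E n} (ha : a ∈ carrier n κ)
    (hx : x ∈ carrier n κ) (hne : x ≠ a) :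
    HasFDerivAt (rdist κ a)
      ((p κ x ^ 2 / sn κ (rdist κ a x)) • innerSL ℝ (field κ a x)) x := by
  rw [rdist_eq_modelDist hκ ha hx]
  exact (hasFDerivAt_modelDist hκ ha hx hne).congr_of_eventuallyEq (rdist_eventuallyEq hκ ha hx)

theorem p_sq_mul_norm_field_sq' (hκ : 0 ≤ κ) {a x : E n} (ha : a ∈ carrier n κ)
    (hx : x ∈ carrier n κ) :
    p κ x ^ 2 * ‖field κ a x‖ ^ 2 = sn κ (rdist κ a x) ^ 2 := by
  rw [rdist_eq_modelDist hκ ha hx, p_sq_mul_norm_field_sq ha hx]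

theorem fderiv_p_field' (hκ : 0 ≤ κ) {a x : E n} (ha : a ∈ carrier n κ)
    (hx : x ∈ carrier n κ) :
    fderiv ℝ (p κ) x (field κ a x) = p κ x * (cs κ (rdist κ a x) - fieldFactor κ a x) := by
  rw [rdist_eq_modelDist hκ ha hx, fderiv_p_field ha hx]

/-- Comparison of the Euclidean distance with `s_κ(ρ)`. -/
theorem exists_norm_sub_le_sn (hκ : 0 ≤ κ) {a : E n} (ha : a ∈ carrier n κ) :
    ∃ c > 0, ∀ x ∈ carrier n κ, ‖x - a‖ ≤ c * sn κ (rdist κ a x) := by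
  by_cases h : κ = 0
  · refine ⟨1, one_pos, fun x hx => ?_⟩
    rw [rdist_eq_modelDist hκ ha hx]
    simp [sn, modelDist, h]
  · have hκ0 : 0 < κ := lt_of_le_of_ne hκ (Ne.symm h)
    refine ⟨κ / 2, by positivity, fun x hx => ?_⟩
    rw [rdist_eq_modelDist hκ ha hx, sn_modelDist h ha hx]
    have hq := halfSinhSq_nonneg h ha hx
    have hA := norm_sq_lt_one h ha
    have hX := norm_sq_lt_one h hx
    rw [show κ / 2 * (2 / κ * √(halfSinhSq a x * (1 + halfSinhSq a x))) =
      √(halfSinhSq a x * (1 + halfSinhSq a x)) by field_simp]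
    refine Real.le_sqrt_of_sq_le ?_
    have h1 : ‖x - a‖ ^ 2 ≤ halfSinhSq a x := by
      rw [halfSinhSq, le_div_iff₀ (mul_pos (by linarith) (by linarith))]
      refine mul_le_of_le_one_right (sq_nonneg _) ?_
      nlinarith [sq_nonneg ‖x‖, sq_nonneg ‖a‖]
    nlinarith

/-! ### Euclidean divergence, Hessian symmetry and the radial derivative. -/

theorem contDiff_gradient {u : E n → ℝ} (hu : ContDiff ℝ ∞ u) : ContDiff ℝ ∞ (gradient u) := by
  have h1 : ContDiff ℝ ∞ (fderiv ℝ u) := hu.fderiv_right (by simp)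
  exact ((InnerProductSpace.toDual ℝ (E n)).symm.toContinuousLinearEquiv.contDiff).comp h1

theorem inner_fderiv_gradient_comm {u : E n → ℝ} (hu : ContDiff ℝ ∞ u) (x ξ η : E n) :
    ⟪fderiv ℝ (gradient u) x ξ, η⟫ = ⟪fderiv ℝ (gradient u) x η, ξ⟫ := by
  have hg : DifferentiableAt ℝ (gradient u) x := (contDiff_gradient hu).differentiable (by simp) x
  have hu2 : DifferentiableAt ℝ (fderiv ℝ u) x :=
    (hu.fderiv_right (m := ∞) (by simp)).differentiable (by simp) x
  have key : ∀ ξ η : E n, ⟪fderiv ℝ (gradient u) x ξ, η⟫ = fderiv ℝ (fderiv ℝ u) x ξ η := by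
    intro ξ η
    have h1 := hg.hasFDerivAt.inner ℝ (hasFDerivAt_const η x)
    have h2 := hu2.hasFDerivAt.clm_apply (hasFDerivAt_const η x)
    have h3 : (fun y => ⟪gradient u y, η⟫) = fun y => fderiv ℝ u y η := by
      funext y; exact inner_gradient_left
    rw [h3] at h1
    have h4 := DFunLike.congr_fun (h1.unique h2) ξ
    simpa using h4
  have hs : IsSymmSndFDerivAt ℝ u x := hu.contDiffAt.isSymmSndFDerivAt (by
    simpa using ENat.LEInfty.out)
  rw [key, key, hs.eq]

theorem sum_smul_single (z : E n) : ∑ i, z i • EuclideanSpace.single i (1 : ℝ) = z := by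
  simpa using (EuclideanSpace.basisFun (Fin n) ℝ).sum_repr z

theorem euclDiv_smul {f : E n → ℝ} {Z : E n → E n} {x : E n} (hf : DifferentiableAt ℝ f x)
    (hZ : DifferentiableAt ℝ Z x) :
    euclDiv (fun y => f y • Z y) x = fderiv ℝ f x (Z x) + f x * euclDiv Z x := by
  unfold euclDiv
  rw [fderiv_fun_smul hf hZ]
  conv_rhs => rw [← sum_smul_single (Z x), map_sum]
  simp [Finset.sum_add_distrib, Finset.mul_sum, mul_comm, add_comm]

theorem euclDiv_sub {Y Z : E n → E n} {x : E n} (hY : DifferentiableAt ℝ Y x)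
    (hZ : DifferentiableAt ℝ Z x) :
    euclDiv (fun y => Y y - Z y) x = euclDiv Y x - euclDiv Z x := by
  unfold euclDiv
  rw [fderiv_fun_sub hY hZ]
  simp [Finset.sum_sub_distrib]

theorem euclDiv_field (κ : ℝ) (a x : E n) :
    euclDiv (field κ a) x = n * fieldFactor κ a x := by
  have : ∀ i : Fin n, (fderiv ℝ (field κ a) x (EuclideanSpace.single i 1)) i =
      fieldFactor κ a x := by
    intro i
    have h := inner_fderiv_field κ a x (EuclideanSpace.single i (1 : ℝ))
    simpa [EuclideanSpace.inner_single_right] using h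
  simp [euclDiv, this]

theorem radDeriv_eq (hκ : 0 ≤ κ) {a x : E n} (ha : a ∈ carrier n κ) (hx : x ∈ carrier n κ)
    (hne : x ≠ a) (u : E n → ℝ) :
    radDeriv κ a u x = ⟪gradient u x, field κ a x⟫ / sn κ (rdist κ a x) := by
  have hg : HasGradientAt (rdist κ a) ((p κ x ^ 2 / sn κ (rdist κ a x)) • field κ a x) x := by
    rw [hasGradientAt_iff_hasFDerivAt]
    refine (hasFDerivAt_rdist hκ ha hx hne).congr_fderiv ?_
    ext ξ
    simp
  have hp := (p_pos hκ hx).ne'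
  simp only [radDeriv, metric, grad, hg.gradient, inner_smul_left, inner_smul_right,
    RCLike.conj_to_real]
  field_simp

theorem tangentNorm_grad_sq (hκ : 0 ≤ κ) {x : E n} (hx : x ∈ carrier n κ) (u : E n → ℝ) :
    tangentNorm κ x (grad κ u x) ^ 2 = ‖gradient u x‖ ^ 2 / p κ x ^ 2 := by
  have hp := p_pos hκ hx
  rw [tangentNorm_eq hκ hx, grad, norm_smul, norm_inv, Real.norm_of_nonneg (by positivity)]
  field_simp

theorem radDeriv_sq_le (hκ : 0 ≤ κ) {a x : E n} (ha : a ∈ carrier n κ) (hx : x ∈ carrier n κ)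
    (hne : x ≠ a) (u : E n → ℝ) :
    radDeriv κ a u x ^ 2 ≤ tangentNorm κ x (grad κ u x) ^ 2 := by
  have hp := p_pos hκ hx
  have hs := sn_pos hκ (rdist_pos hκ ha hx hne)
  rw [tangentNorm_grad_sq hκ hx, radDeriv_eq hκ ha hx hne, div_pow,
    div_le_div_iff₀ (by positivity) (by positivity), ← p_sq_mul_norm_field_sq' hκ ha hx]
  have h1 := real_inner_mul_inner_self_le (gradient u x) (field κ a x)
  rw [real_inner_self_eq_norm_sq, real_inner_self_eq_norm_sq] at h1
  nlinarith [sq_nonneg (p κ x)]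

/-- In dimension one the radial derivative is the whole gradient. -/
theorem radDeriv_sq_eq_of_dim_one (hκ : 0 ≤ κ) {a x : E 1} (ha : a ∈ carrier 1 κ)
    (hx : x ∈ carrier 1 κ) (hne : x ≠ a) (u : E 1 → ℝ) :
    radDeriv κ a u x ^ 2 = tangentNorm κ x (grad κ u x) ^ 2 := by
  have hp := p_pos hκ hx
  have hs := sn_pos hκ (rdist_pos hκ ha hx hne)
  rw [tangentNorm_grad_sq hκ hx, radDeriv_eq hκ ha hx hne, div_pow,
    div_eq_div_iff (by positivity) (by positivity), ← p_sq_mul_norm_field_sq' hκ ha hx]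
  simp only [EuclideanSpace.norm_sq_eq, PiLp.inner_apply, Fin.sum_univ_one, Real.norm_eq_abs,
    sq_abs, RCLike.inner_apply, RCLike.conj_to_real]
  ring

/-! ### The Rellich–Pohozaev identity. -/

/-- The Euclidean density of the Rellich–Pohozaev field `G(ρ) (2 (∂_ρ u) ∇_κ u - |∇_κ u|² ∇_κ ρ)`. -/
def pohozaevField (κ : ℝ) (a : E n) (G : ℝ → ℝ) (u : E n → ℝ) (y : E n) : E n :=
  (G (rdist κ a y) / sn κ (rdist κ a y) * (2 * ⟪gradient u y, field κ a y⟫)) •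
      (p κ y ^ ((n : ℤ) - 2) • gradient u y) -
    (G (rdist κ a y) / sn κ (rdist κ a y) *
      (p κ y ^ ((n : ℤ) - 2) * ‖gradient u y‖ ^ 2)) • field κ a y

/-- Grouping `p^(n-2)∇u` makes its divergence the Laplacian. The two Hessian terms cancel by
symmetry, the derivatives of `field` and `p` combine into `cs(ρ)` by conformality, and
differentiating `G/sn` produces `G' - ct G`. -/
theorem euclDiv_pohozaevField (hκ : 0 ≤ κ) {a x : E n} (ha : a ∈ carrier n κ)
    (hx : x ∈ carrier n κ) (hne : x ≠ a) {u : E n → ℝ} (hu : ContDiff ℝ ∞ u) {G : ℝ → ℝ}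
    (hG : DifferentiableAt ℝ G (rdist κ a x)) :
    euclDiv (pohozaevField κ a G u) x = p κ x ^ n *
      (2 * G (rdist κ a x) * radDeriv κ a u x * laplacian κ u x
        + 2 * (deriv G (rdist κ a x) - ct κ (rdist κ a x) * G (rdist κ a x)) *
          radDeriv κ a u x ^ 2
        - (deriv G (rdist κ a x) + ((n : ℝ) - 3) * ct κ (rdist κ a x) * G (rdist κ a x)) *
          tangentNorm κ x (grad κ u x) ^ 2) := by
  have hp := p_pos hκ hx
  have hs := sn_pos hκ (rdist_pos hκ ha hx hne)
  have hpn : p κ x ^ n = p κ x ^ ((n : ℤ) - 2) * p κ x ^ 2 := by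
    rw [← zpow_natCast (p κ x) 2, ← zpow_add₀ hp.ne']; simp
  have hlap : euclDiv (fun y => p κ y ^ ((n : ℤ) - 2) • gradient u y) x =
      p κ x ^ ((n : ℤ) - 2) * p κ x ^ 2 * laplacian κ u x := by
    rw [laplacian, ← hpn, ← mul_assoc, zpow_neg, zpow_natCast, mul_inv_cancel₀ (by positivity),
      one_mul]
  have hN : DifferentiableAt ℝ (gradient u) x := (contDiff_gradient hu).differentiable (by simp) x
  have hW : DifferentiableAt ℝ (field κ a) x := (contDiff_field κ a).differentiable (by simp) x
  have hpd : DifferentiableAt ℝ (p κ) x := (contDiffAt_p hx).differentiableAt (by simp)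
  have hP : HasFDerivAt (fun y => p κ y ^ ((n : ℤ) - 2)) _ x :=
    (hasDerivAt_zpow ((n : ℤ) - 2) (p κ x) (Or.inl hp.ne')).comp_hasFDerivAt x hpd.hasFDerivAt
  have hφ : HasFDerivAt (fun y => G (rdist κ a y) / sn κ (rdist κ a y)) _ x :=
    (hG.hasDerivAt.div (hasDerivAt_sn κ _) hs.ne').comp_hasFDerivAt x
      (hasFDerivAt_rdist hκ ha hx hne)
  have hm : HasFDerivAt (fun y => (⟪gradient u y, field κ a y⟫ : ℝ)) _ x :=
    hN.hasFDerivAt.inner ℝ hW.hasFDerivAt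
  have hN2 : HasFDerivAt (fun y => ‖gradient u y‖ ^ 2) _ x := hN.hasFDerivAt.norm_sq
  have hf1 := hφ.mul (hm.const_mul 2)
  have hf2 := hφ.mul (hP.mul hN2)
  have hA : DifferentiableAt ℝ (fun y => p κ y ^ ((n : ℤ) - 2) • gradient u y) x :=
    hP.differentiableAt.smul hN
  have e1 := euclDiv_smul hf1.differentiableAt hA
  have e2 := euclDiv_smul hf2.differentiableAt hW
  have e3 := euclDiv_sub (hf1.differentiableAt.smul hA) (hf2.differentiableAt.smul hW)
  rw [hf1.fderiv, hlap] at e1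
  rw [hf2.fderiv, euclDiv_field] at e2
  have e4 : euclDiv (pohozaevField κ a G u) x = _ - _ := e3.trans (congrArg₂ _ e1 e2)
  have hsymm := inner_fderiv_gradient_comm hu x (gradient u x) (field κ a x)
  have hfW := inner_fderiv_field κ a x (gradient u x)
  have hpW := fderiv_p_field' hκ ha hx
  have hsq := p_sq_mul_norm_field_sq' hκ ha hx
  have hz : p κ x ^ ((n : ℤ) - 2 - 1) = p κ x ^ ((n : ℤ) - 2) / p κ x := zpow_sub_one₀ hp.ne' _
  rw [e4, radDeriv_eq hκ ha hx hne, tangentNorm_grad_sq hκ hx, hpn, ct_eq]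
  simp only [add_apply, smul_apply, innerSL_apply_apply, smul_eq_mul,
    ContinuousLinearMap.comp_apply, fderivInnerCLM_apply, ContinuousLinearMap.prod_apply,
    map_smul, hpW, hz, nsmul_eq_mul,
    Pi.mul_apply]
  rw [real_inner_comm (fderiv ℝ (field κ a) x (gradient u x)) (gradient u x), hfW, hsymm,
    real_inner_comm (gradient u x) (field κ a x),
    real_inner_comm (fderiv ℝ (gradient u) x (field κ a x)) (gradient u x),
    real_inner_self_eq_norm_sq (field κ a x)]
  generalize p κ x ^ ((n : ℤ) - 2) = B at *
  generalize ⟪fderiv ℝ (gradient u) x (field κ a x), gradient u x⟫ = T at *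
  generalize laplacian κ u x = Δ at *
  generalize ⟪gradient u x, field κ a x⟫ = m at *
  generalize ‖gradient u x‖ ^ 2 = N at *
  push_cast
  have hsq' : ‖field κ a x‖ ^ 2 = sn κ (rdist κ a x) ^ 2 / p κ x ^ 2 := by
    rw [← hsq]; field_simp
  rw [hsq']
  field_simp
  ring

/-! ### The radial interval. -/

theorem isOpen_radialInterval (κ : ℝ) (Ω : Set (E n)) (x₀ : E n) :
    IsOpen (radialInterval κ Ω x₀) :=
  (isOpen_lt continuous_const continuous_id).inter
    (isOpen_lt continuous_coe_real_ereal continuous_const)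

theorem convex_radialInterval (κ : ℝ) (Ω : Set (E n)) (x₀ : E n) :
    Convex ℝ (radialInterval κ Ω x₀) := by
  refine Set.OrdConnected.convex ⟨fun s hs t ht r hr => ⟨hs.1.trans_le hr.1, ?_⟩⟩
  exact lt_of_le_of_lt (EReal.coe_le_coe_iff.2 hr.2) ht.2

/-- The supremum of the distance is not attained off the centre: the domain is open, so a maximum
would be a critical point, whereas the derivative of the distance along `field` is `sn(ρ) ≠ 0`. -/
theorem rdist_mem_radialInterval (hκ : 0 ≤ κ) {Ω : Set (E n)} (hΩ : IsOpen Ω)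
    (hΩM : Ω ⊆ carrier n κ) {x₀ x : E n} (hx₀ : x₀ ∈ Ω) (hx : x ∈ Ω) (hne : x ≠ x₀) :
    rdist κ x₀ x ∈ radialInterval κ Ω x₀ := by
  have ha := hΩM hx₀
  have hs := sn_pos hκ (rdist_pos hκ ha (hΩM hx) hne)
  refine ⟨rdist_pos hκ ha (hΩM hx) hne, ?_⟩
  by_contra hcon
  rw [not_lt, iSup₂_le_iff] at hcon
  have hmax : IsLocalMax (rdist κ x₀) x :=
    Filter.eventually_of_mem (hΩ.mem_nhds hx) fun y hy => EReal.coe_le_coe_iff.1 (hcon y hy)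
  have h0 := hmax.fderiv_eq_zero
  rw [(hasFDerivAt_rdist hκ ha (hΩM hx) hne).fderiv] at h0
  have h1 := DFunLike.congr_fun h0 (field κ x₀ x)
  have hsq := p_sq_mul_norm_field_sq' hκ ha (hΩM hx)
  simp only [smul_apply, innerSL_apply_apply, real_inner_self_eq_norm_sq, smul_eq_mul,
    zero_apply] at h1
  rw [div_mul_eq_mul_div, hsq, div_eq_zero_iff] at h1
  rcases h1 with h1 | h1
  · exact hs.ne' (pow_eq_zero_iff two_ne_zero |>.1 h1)
  · exact hs.ne' h1

/-! ### Consequences of the Riccati inequality: sign and growth of `vH`. -/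

section DualPair

variable {Ω : Set (E n)} {x₀ : E n} {v V H : ℝ → ℝ} {t : ℝ}

namespace IsDualAdmissible

theorem hasDerivAt_v (hH : IsDualAdmissible κ Ω x₀ v V H) (ht : t ∈ radialInterval κ Ω x₀) :
    HasDerivAt v (deriv v t) t :=
  ((hH.smooth_v.contDiffAt ((isOpen_radialInterval κ Ω x₀).mem_nhds ht)).differentiableAt
    (by simp)).hasDerivAt

theorem hasDerivAt_H (hH : IsDualAdmissible κ Ω x₀ v V H) (ht : t ∈ radialInterval κ Ω x₀) :
    HasDerivAt H (deriv H t) t :=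
  ((hH.smooth_H.contDiffAt ((isOpen_radialInterval κ Ω x₀).mem_nhds ht)).differentiableAt
    (by simp)).hasDerivAt

theorem hasDerivAt_mul (hH : IsDualAdmissible κ Ω x₀ v V H) (ht : t ∈ radialInterval κ Ω x₀) :
    HasDerivAt (fun s => v s * H s) (deriv v t * H t + v t * deriv H t) t :=
  (hH.hasDerivAt_v ht).mul (hH.hasDerivAt_H ht)

/-- The Riccati inequality multiplied by the weight; it persists at the zeros of the weight. -/
theorem mul_le (hH : IsDualAdmissible κ Ω x₀ v V H) (ht : t ∈ radialInterval κ Ω x₀) :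
    v t * V t ≤ -deriv (fun s => v s * H s) t + L n κ t * (v t * H t) - v t * H t ^ 2 := by
  rw [(hH.hasDerivAt_mul ht).deriv]
  by_cases h0 : v t = 0
  -- A zero of the nonnegative weight is an interior minimum, so `v'` vanishes there as well and
  -- both sides are zero.
  · have hmin : IsLocalMin v t :=
      Filter.eventually_of_mem ((isOpen_radialInterval κ Ω x₀).mem_nhds ht) fun s hs => by
        rw [h0]; exact hH.nonneg_v s hs
    simp [h0, hmin.deriv_eq_zero]
  · have h1 := mul_le_mul_of_nonneg_left (hH.riccati t ht h0) (hH.nonneg_v t ht)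
    refine h1.trans (le_of_eq ?_)
    field_simp
    ring

/-- `E₁ - E₂` is exactly the right side of the weighted Riccati inequality. -/
theorem mul_le_E₁ (hH : IsDualAdmissible κ Ω x₀ v V H) (ht : t ∈ radialInterval κ Ω x₀)
    (h2 : 0 ≤ E₂ κ v H t) : v t * V t ≤ E₁ n κ v H t := by
  have h1 := hH.mul_le ht
  unfold E₂ at h2
  unfold E₁
  linarith

/-- Adding `E₁ ≥ 0` to the weighted Riccati inequality cancels `(vH)'`. The factor `2n - 4` then
decides the sign of `vH` in each dimension. -/
theorem mul_sq_le (hH : IsDualAdmissible κ Ω x₀ v V H) (ht : t ∈ radialInterval κ Ω x₀)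
    (h1 : 0 ≤ E₁ n κ v H t) :
    v t * H t ^ 2 ≤ (2 * (n : ℝ) - 4) * (ct κ t * (v t * H t)) := by
  have h2 := hH.mul_le ht
  have h3 := mul_nonneg (hH.nonneg_v t ht) (hH.nonneg_V t ht)
  unfold E₁ at h1
  unfold L at h1 h2
  linarith

theorem ct_pos (hκ : 0 ≤ κ) (ht : t ∈ radialInterval κ Ω x₀) : 0 < ct κ t := by
  rw [ct_eq]; exact div_pos (cs_pos κ t) (sn_pos hκ ht.1)

theorem mul_nonpos_of_dim_one (hκ : 0 ≤ κ) (hH : IsDualAdmissible κ Ω x₀ v V H) (hn : n = 1)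
    (ht : t ∈ radialInterval κ Ω x₀) (h1 : 0 ≤ E₁ n κ v H t) : v t * H t ≤ 0 := by
  have h2 := hH.mul_sq_le ht h1
  have h3 := mul_nonneg (hH.nonneg_v t ht) (sq_nonneg (H t))
  have h4 := ct_pos hκ ht
  rw [hn] at h2
  by_contra hc
  have := mul_pos h4 (not_le.1 hc)
  norm_num at h2
  linarith

theorem mul_eq_zero_of_dim_two (hH : IsDualAdmissible κ Ω x₀ v V H) (hn : n = 2)
    (ht : t ∈ radialInterval κ Ω x₀) (h1 : 0 ≤ E₁ n κ v H t) : v t * H t = 0 := by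
  have h2 := hH.mul_sq_le ht h1
  have h3 := mul_nonneg (hH.nonneg_v t ht) (sq_nonneg (H t))
  rw [hn] at h2
  norm_num at h2
  have h4 : v t * H t ^ 2 = 0 := le_antisymm h2 h3
  rcases mul_eq_zero.1 h4 with h | h
  · simp [h]
  · simp [pow_eq_zero_iff two_ne_zero |>.1 h]

theorem mul_nonneg_of_three_le (hκ : 0 ≤ κ) (hH : IsDualAdmissible κ Ω x₀ v V H) (hn : 3 ≤ n)
    (ht : t ∈ radialInterval κ Ω x₀) (h1 : 0 ≤ E₁ n κ v H t) : 0 ≤ v t * H t := by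
  have h2 := hH.mul_sq_le ht h1
  have h3 := mul_nonneg (hH.nonneg_v t ht) (sq_nonneg (H t))
  have h4 := ct_pos hκ ht
  have h5 : (3 : ℝ) ≤ n := by exact_mod_cast hn
  have h6 : 0 ≤ ((2 * (n : ℝ) - 4) * ct κ t) * (v t * H t) := by linarith
  exact nonneg_of_mul_nonneg_right h6 (mul_pos (by linarith) h4)

/-- `sn^(n-3)` is an integrating factor: the derivative is `sn^(n-3) E₁`. Monotonicity bounds `vH`
by a multiple of `sn^(3-n)` near the centre. -/
theorem monotoneOn_mul_sn_pow (hκ : 0 ≤ κ) (hH : IsDualAdmissible κ Ω x₀ v V H) (hn : 3 ≤ n)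
    (h1 : ∀ t ∈ radialInterval κ Ω x₀, 0 ≤ E₁ n κ v H t) :
    MonotoneOn (fun t => v t * H t * sn κ t ^ (n - 3)) (radialInterval κ Ω x₀) := by
  have hd : ∀ t ∈ radialInterval κ Ω x₀, HasDerivAt (fun t => v t * H t * sn κ t ^ (n - 3))
      (sn κ t ^ (n - 3) * E₁ n κ v H t) t := by
    intro t ht
    refine ((hH.hasDerivAt_mul ht).mul ((hasDerivAt_sn κ t).pow (n - 3))).congr_deriv ?_
    have hs := (sn_pos hκ ht.1).ne'
    rw [E₁, (hH.hasDerivAt_mul ht).deriv, L, ct_eq]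
    obtain ⟨m, rfl⟩ := Nat.exists_eq_add_of_le hn
    -- The case `n = 3` is separate because the derivative of the power carries the truncated
    -- exponent `n - 3 - 1`.
    rcases m with _ | m
    · simp only [Nat.add_zero, Nat.sub_self, pow_zero, Pi.pow_apply]
      push_cast
      ring
    · simp only [Nat.add_sub_cancel_left]
      push_cast
      simp only [Pi.pow_apply]
      field_simp
      ring
  refine monotoneOn_of_deriv_nonneg (convex_radialInterval κ Ω x₀)
    (fun t ht => (hd t ht).continuousAt.continuousWithinAt) ?_ ?_
  · rw [(isOpen_radialInterval κ Ω x₀).interior_eq]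
    exact fun t ht => (hd t ht).differentiableAt.differentiableWithinAt
  · rw [(isOpen_radialInterval κ Ω x₀).interior_eq]
    intro t ht
    rw [(hd t ht).deriv]
    exact mul_nonneg (pow_nonneg (sn_pos hκ ht.1).le _) (h1 t ht)

end IsDualAdmissible

end DualPair

/-! ### The divergence theorem, and regularity of the integrands. -/

/-- The divergence theorem for compactly supported fields. -/
theorem integral_euclDiv_eq_zero {F : E n → E n} (hF : ContDiff ℝ 1 F) (hc : HasCompactSupport F) :
    Integrable (euclDiv F) ∧ ∫ x, euclDiv F x = 0 := by
  have hcd : Continuous (fderiv ℝ F) := hF.continuous_fderiv one_ne_zero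
  have hint : ∀ i : Fin n,
      Integrable (fun x => (fderiv ℝ F x (EuclideanSpace.single i 1)) i) := by
    intro i
    refine Continuous.integrable_of_hasCompactSupport (by fun_prop) ?_
    exact (hc.fderiv ℝ).comp_left (g := fun A : E n →L[ℝ] E n => (A (EuclideanSpace.single i 1)) i)
      (by simp)
  refine ⟨integrable_finsetSum _ fun i _ => hint i, ?_⟩
  unfold euclDiv
  rw [integral_finsetSum _ fun i _ => hint i]
  refine Finset.sum_eq_zero fun i _ => ?_
  have hFi : ContDiff ℝ 1 (fun x => F x i) := by fun_prop
  have hd : ∀ x, fderiv ℝ (fun x => F x i) x (EuclideanSpace.single i 1) =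
      (fderiv ℝ F x (EuclideanSpace.single i 1)) i := by
    intro x
    have h1 := (EuclideanSpace.proj (𝕜 := ℝ) i).hasFDerivAt.comp x
      (hF.differentiable one_ne_zero x).hasFDerivAt
    have h2 : fderiv ℝ (fun x => F x i) x = _ := h1.fderiv
    rw [h2]; simp
  -- Integration by parts against the constant `1`.
  have h := integral_mul_fderiv_eq_neg_fderiv_mul_of_integrable (μ := (volume : Measure (E n)))
    (f := fun _ => (1 : ℝ)) (g := fun x => F x i) (v := EuclideanSpace.single i 1)
    (by simp) (by simpa [hd] using hint i)
    (by simpa using hFi.continuous.integrable_of_hasCompactSupport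
          (hc.comp_left (g := fun z : E n => z i) (by simp)))
    (fun x _ => differentiableAt_const _) (fun x _ => hFi.differentiable one_ne_zero x)
  simpa [hd] using h

theorem continuousAt_p {x : E n} (hx : x ∈ carrier n κ) : ContinuousAt (p κ) x :=
  (contDiffAt_p hx).continuousAt

theorem continuousAt_radDeriv (hκ : 0 ≤ κ) {a x : E n} (ha : a ∈ carrier n κ)
    (hx : x ∈ carrier n κ) (hne : x ≠ a) {u : E n → ℝ} (hu : ContDiff ℝ ∞ u) :
    ContinuousAt (radDeriv κ a u) x := by
  have h1 : (fun y => ⟪gradient u y, field κ a y⟫ / sn κ (rdist κ a y)) =ᶠ[𝓝 x]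
      radDeriv κ a u := by
    filter_upwards [(isOpen_carrier n κ).mem_nhds hx, isOpen_ne.mem_nhds hne] with y hy hya
    exact (radDeriv_eq hκ ha hy hya u).symm
  refine ContinuousAt.congr ?_ h1
  exact (((contDiff_gradient hu).continuous.inner
    (contDiff_field κ a).continuous).continuousAt).div
    ((contDiff_sn κ).continuous.continuousAt.comp (continuousAt_rdist hκ ha hx))
    (sn_pos hκ (rdist_pos hκ ha hx hne)).ne'

theorem continuousAt_tangentNorm_grad_sq (hκ : 0 ≤ κ) {x : E n}
    (hx : x ∈ carrier n κ) {u : E n → ℝ} (hu : ContDiff ℝ ∞ u) :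
    ContinuousAt (fun y => tangentNorm κ y (grad κ u y) ^ 2) x := by
  have h1 : (fun y => ‖gradient u y‖ ^ 2 / p κ y ^ 2) =ᶠ[𝓝 x]
      fun y => tangentNorm κ y (grad κ u y) ^ 2 := by
    filter_upwards [(isOpen_carrier n κ).mem_nhds hx] with y hy
    exact (tangentNorm_grad_sq hκ hy u).symm
  refine ContinuousAt.congr ?_ h1
  exact ((contDiff_gradient hu).continuous.continuousAt.norm.pow 2).div
    ((continuousAt_p hx).pow 2) (pow_pos (p_pos hκ hx) 2).ne'

theorem contDiffAt_p_zpow (hκ : 0 ≤ κ) {x : E n} (hx : x ∈ carrier n κ) (m : ℤ) :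
    ContDiffAt ℝ ∞ (fun y => p κ y ^ m) x := by
  have hp := (p_pos hκ hx).ne'
  rcases m with k | k
  · simpa using (contDiffAt_p hx).pow k
  · simp only [zpow_negSucc]
    exact ((contDiffAt_p hx).pow (k + 1)).inv (pow_ne_zero _ hp)

theorem continuousAt_laplacian (hκ : 0 ≤ κ) {x : E n}
    (hx : x ∈ carrier n κ) {u : E n → ℝ} (hu : ContDiff ℝ ∞ u) :
    ContinuousAt (laplacian κ u) x := by
  have hA : ContDiffAt ℝ ∞ (fun y => p κ y ^ ((n : ℤ) - 2) • gradient u y) x :=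
    (contDiffAt_p_zpow hκ hx _).smul (contDiff_gradient hu).contDiffAt
  have hd := (hA.fderiv_right (m := ∞) (by simp)).continuousAt
  refine (contDiffAt_p_zpow hκ hx _).continuousAt.mul ?_
  unfold euclDiv
  fun_prop

section Support

variable {u : E n → ℝ} {x : E n}

theorem gradient_eventuallyEq_zero (hx : x ∉ tsupport u) : gradient u =ᶠ[𝓝 x] 0 := by
  have h1 := notMem_tsupport_iff_eventuallyEq.1 hx
  refine h1.gradient.trans (Filter.Eventually.of_forall fun y => ?_)
  exact gradient_fun_const y 0

theorem radDeriv_eq_zero (a : E n) (hx : gradient u x = 0) : radDeriv κ a u x = 0 := by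
  simp [radDeriv, metric, grad, hx]

theorem tangentNorm_grad_eq_zero (hx : gradient u x = 0) :
    tangentNorm κ x (grad κ u x) = 0 := by
  simp [tangentNorm, metric, grad, hx]

theorem laplacian_eq_zero (hx : x ∉ tsupport u) : laplacian κ u x = 0 := by
  have h1 : (fun y => p κ y ^ ((n : ℤ) - 2) • gradient u y) =ᶠ[𝓝 x] fun _ => 0 := by
    filter_upwards [gradient_eventuallyEq_zero hx] with y hy
    simp [hy]
  simp [laplacian, euclDiv, h1.fderiv_eq]

end Support

/-- The integrands are regular only on the domain minus the centre; the cutoff takes care of the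
centre and the support of `u` of the complement. -/
theorem continuous_of_continuousAt_off_point {Ω K : Set (E n)} {a : E n} {f : E n → ℝ}
    (hK : IsCompact K) (hKΩ : K ⊆ Ω) (h0 : ∀ x ∉ K, f x = 0) (ha : f =ᶠ[𝓝 a] 0)
    (hf : ∀ x ∈ Ω, x ≠ a → ContinuousAt f x) : Continuous f ∧ HasCompactSupport f := by
  refine ⟨continuous_iff_continuousAt.2 fun x => ?_, HasCompactSupport.intro hK h0⟩
  by_cases hxa : x = a
  · subst hxa
    exact continuousAt_const.congr ha.symm
  by_cases hx : x ∈ K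
  · exact hf x (hKΩ hx) hxa
  · refine continuousAt_const.congr (f := fun _ => (0 : ℝ)) ?_
    exact Filter.eventually_of_mem (hK.isClosed.isOpen_compl.mem_nhds hx) fun y hy => (h0 y hy).symm

/-! ### The cutoff at the centre and its flux error. -/

/-- A cutoff vanishing where `s_κ ≤ ε` and equal to `1` where `s_κ ≥ 2ε`. -/
def cutoff (κ ε t : ℝ) : ℝ := Real.smoothTransition (sn κ t / ε - 1)

theorem contDiff_cutoff (κ ε : ℝ) : ContDiff ℝ ∞ (cutoff κ ε) :=
  Real.smoothTransition.contDiff.comp (((contDiff_sn κ).div_const ε).sub contDiff_const)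

theorem cutoff_nonneg (κ ε t : ℝ) : 0 ≤ cutoff κ ε t := Real.smoothTransition.nonneg _

theorem cutoff_le_one (κ ε t : ℝ) : cutoff κ ε t ≤ 1 := Real.smoothTransition.le_one _

theorem cutoff_eq_zero {ε t : ℝ} (hε : 0 < ε) (h : sn κ t ≤ ε) : cutoff κ ε t = 0 :=
  Real.smoothTransition.zero_of_nonpos (by rw [sub_nonpos, div_le_one hε]; exact h)

theorem cutoff_eq_one {ε t : ℝ} (hε : 0 < ε) (h : 2 * ε ≤ sn κ t) : cutoff κ ε t = 1 :=
  Real.smoothTransition.one_of_one_le (by rw [le_sub_iff_add_le, le_div_iff₀ hε]; linarith)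

theorem deriv_smoothTransition_nonneg (s : ℝ) : 0 ≤ deriv Real.smoothTransition s :=
  Real.smoothTransition.monotone.deriv_nonneg

theorem deriv_smoothTransition_eq_zero {s : ℝ} (h : s ≤ 0 ∨ 1 ≤ s) :
    deriv Real.smoothTransition s = 0 := by
  rcases h with h | h
  · refine IsLocalMin.deriv_eq_zero (Filter.Eventually.of_forall fun y => ?_)
    rw [Real.smoothTransition.zero_of_nonpos h]
    exact Real.smoothTransition.nonneg _
  · refine IsLocalMax.deriv_eq_zero (Filter.Eventually.of_forall fun y => ?_)
    rw [Real.smoothTransition.one_of_one_le h]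
    exact Real.smoothTransition.le_one _

theorem exists_deriv_smoothTransition_le : ∃ C, ∀ s, deriv Real.smoothTransition s ≤ C := by
  have hc : Continuous (deriv Real.smoothTransition) :=
    (Real.smoothTransition.contDiff (n := 1)).continuous_deriv le_rfl
  obtain ⟨C, hC⟩ := (isCompact_Icc (a := (0 : ℝ)) (b := 1)).exists_bound_of_continuousOn
    hc.continuousOn
  have hC0 : 0 ≤ C := (norm_nonneg _).trans (hC 0 ⟨le_rfl, zero_le_one⟩)
  refine ⟨C, fun s => ?_⟩
  by_cases hs : s ∈ Icc (0 : ℝ) 1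
  · exact (le_abs_self _).trans (hC s hs)
  · rw [deriv_smoothTransition_eq_zero]
    · exact hC0
    · simp only [mem_Icc, not_and_or, not_le] at hs
      exact hs.imp le_of_lt le_of_lt

theorem deriv_cutoff (κ ε t : ℝ) :
    deriv (cutoff κ ε) t = deriv Real.smoothTransition (sn κ t / ε - 1) * (cs κ t / ε) := by
  have h1 : HasDerivAt (fun s => sn κ s / ε - 1) (cs κ t / ε) t :=
    ((hasDerivAt_sn κ t).div_const ε).sub_const 1
  have h2 := ((Real.smoothTransition.contDiff (n := 1)).differentiable one_ne_zero
    (sn κ t / ε - 1)).hasDerivAt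
  exact (h2.comp t h1).deriv

theorem deriv_cutoff_nonneg {ε : ℝ} (hε : 0 < ε) (t : ℝ) : 0 ≤ deriv (cutoff κ ε) t := by
  rw [deriv_cutoff]
  exact mul_nonneg (deriv_smoothTransition_nonneg _) (div_pos (cs_pos κ t) hε).le

theorem nontrivial_E (hn : 1 ≤ n) : Nontrivial (E n) := by
  have : Nonempty (Fin n) := ⟨⟨0, hn⟩⟩
  infer_instance

section Main

variable {Ω : Set (E n)} {x₀ : E n} {v V H : ℝ → ℝ} {u : E n → ℝ}

/-- The flux through a small geodesic sphere around the centre is, up to `O(ε²)`, nonnegative. -/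
theorem exists_flux_le (hκ : 0 ≤ κ) (hn : 1 ≤ n) (hΩ : IsOpen Ω) (hΩM : Ω ⊆ carrier n κ)
    (hx₀ : x₀ ∈ Ω) (hH : IsDualAdmissible κ Ω x₀ v V H)
    (h1 : ∀ t ∈ radialInterval κ Ω x₀, 0 ≤ E₁ n κ v H t) (hu : IsTestFunction Ω u) :
    ∃ C ≥ 0, ∃ c > 0, ∃ ε₀ > 0, ∀ ε, 0 < ε → ε < ε₀ → ∀ x ∈ Ω, x ≠ x₀ →
      p κ x ^ n * (deriv (cutoff κ ε) (rdist κ x₀ x) * (v (rdist κ x₀ x) * H (rdist κ x₀ x))) *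
        (2 * radDeriv κ x₀ u x ^ 2 - tangentNorm κ x (grad κ u x) ^ 2) ≤
      (Metric.closedBall x₀ (c * ε)).indicator (fun _ => C * (ε ^ 2 / ε ^ n)) x := by
  have ha := hΩM hx₀
  have hI : ∀ x ∈ Ω, x ≠ x₀ → rdist κ x₀ x ∈ radialInterval κ Ω x₀ := fun x hx hne =>
    rdist_mem_radialInterval hκ hΩ hΩM hx₀ hx hne
  rcases Nat.lt_or_ge n 3 with hn3 | hn3
  · refine ⟨0, le_rfl, 1, one_pos, 1, one_pos, fun ε hε _ x hx hne => ?_⟩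
    simp only [zero_mul, indicator_zero]
    have hp := p_pos hκ (hΩM hx)
    have hd := deriv_cutoff_nonneg (κ := κ) hε (rdist κ x₀ x)
    have hn12 : n = 1 ∨ n = 2 := by omega
    rcases hn12 with h | h
    · have hG := IsDualAdmissible.mul_nonpos_of_dim_one hκ hH h (hI x hx hne) (h1 _ (hI x hx hne))
      subst h
      rw [← radDeriv_sq_eq_of_dim_one hκ ha (hΩM hx) hne]
      refine mul_nonpos_of_nonpos_of_nonneg ?_ (by nlinarith [sq_nonneg (radDeriv κ x₀ u x)])
      exact mul_nonpos_of_nonneg_of_nonpos (by positivity)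
        (mul_nonpos_of_nonneg_of_nonpos hd hG)
    · have hG := hH.mul_eq_zero_of_dim_two h (hI x hx hne) (h1 _ (hI x hx hne))
      simp [hG]
  · have := nontrivial_E hn
    obtain ⟨C₃, hC₃⟩ := exists_deriv_smoothTransition_le
    have hC₃0 : 0 ≤ C₃ := (deriv_smoothTransition_nonneg 0).trans (hC₃ 0)
    obtain ⟨c, hc, hball⟩ := exists_norm_sub_le_sn hκ ha
    obtain ⟨z, hz, hzne⟩ : ∃ z ∈ Ω, z ≠ x₀ := by
      have := ((hΩ.mem_nhds hx₀ : Ω ∈ 𝓝 x₀))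
      obtain ⟨z, hz⟩ := (Filter.inter_mem (mem_nhdsWithin_of_mem_nhds this)
        (self_mem_nhdsWithin : ({x₀}ᶜ : Set (E n)) ∈ 𝓝[≠] x₀)) |> Filter.nonempty_of_mem
      exact ⟨z, hz.1, hz.2⟩
    have hz1 := hI z hz hzne
    set t₁ := rdist κ x₀ z with ht₁
    have hs₁ := sn_pos hκ hz1.1
    have hcont : ContinuousOn (fun x => p κ x ^ n * cs κ (rdist κ x₀ x) *
        tangentNorm κ x (grad κ u x) ^ 2) (tsupport u) := fun x hx =>
      have hxM := hΩM (hu.tsupport_subset hx)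
      ((((continuousAt_p hxM).pow n).mul ((contDiff_cs κ).continuous.continuousAt.comp
        (continuousAt_rdist hκ ha hxM))).mul
        (continuousAt_tangentNorm_grad_sq hκ hxM hu.smooth)).continuousWithinAt
    obtain ⟨C₁, hC₁⟩ := IsCompact.exists_bound_of_continuousOn hu.hasCompactSupport hcont
    set C₂ := v t₁ * H t₁ * sn κ t₁ ^ (n - 3) with hC₂
    have hC₂0 : 0 ≤ C₂ := mul_nonneg
      (IsDualAdmissible.mul_nonneg_of_three_le hκ hH hn3 hz1 (h1 _ hz1)) (pow_pos hs₁ _).le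
    -- `C₁` bounds `p^n cs |∇u|²` on the support, `C₃` the slope of the transition profile, and `C₂`
    -- is `vH sn^(n-3)` at a reference distance `t₁`. The transition shell has `sn ≤ 2ε`, whence the
    -- radius `2cε`; `ε < sn(t₁)/2` keeps the shell within distance `t₁`.
    refine ⟨|C₁| * C₃ * C₂, by positivity, c * 2, by positivity, sn κ t₁ / 2, by positivity, ?_⟩
    intro ε hε hε₀ x hx hne
    have hxI := hI x hx hne
    have hp := p_pos hκ (hΩM hx)
    have hG := IsDualAdmissible.mul_nonneg_of_three_le hκ hH hn3 hxI (h1 _ hxI)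
    have hs := sn_pos hκ hxI.1
    have hrhs : 0 ≤ (Metric.closedBall x₀ (c * 2 * ε)).indicator
        (fun _ => |C₁| * C₃ * C₂ * (ε ^ 2 / ε ^ n)) x :=
      indicator_nonneg (fun _ _ => by positivity) x
    by_cases hout : sn κ (rdist κ x₀ x) ≤ ε ∨ 2 * ε ≤ sn κ (rdist κ x₀ x)
    · rw [deriv_cutoff, deriv_smoothTransition_eq_zero]
      · simpa using hrhs
      · refine hout.imp (fun h => ?_) (fun h => ?_)
        · rw [sub_nonpos, div_le_one hε]; exact h
        · rw [le_sub_iff_add_le, le_div_iff₀ hε]; linarith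
    by_cases hxs : x ∈ tsupport u
    swap
    · have hg := (gradient_eventuallyEq_zero hxs).eq_of_nhds
      rw [radDeriv_eq_zero _ hg, tangentNorm_grad_eq_zero hg]
      simpa using hrhs
    simp only [not_or, not_le] at hout
    have hmem : x ∈ Metric.closedBall x₀ (c * 2 * ε) := by
      rw [mem_closedBall_iff_norm]
      refine (hball x (hΩM hx)).trans ?_
      rw [mul_assoc]
      exact mul_le_mul_of_nonneg_left hout.2.le hc.le
    rw [indicator_of_mem hmem]
    have hle : rdist κ x₀ x ≤ t₁ :=
      ((sn_strictMono κ).le_iff_le).1 (by linarith [hout.2])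
    have hmono := IsDualAdmissible.monotoneOn_mul_sn_pow hκ hH hn3 h1 hxI hz1 hle
    have hGle : v (rdist κ x₀ x) * H (rdist κ x₀ x) ≤ C₂ / ε ^ (n - 3) := by
      rw [le_div_iff₀ (by positivity)]
      exact (mul_le_mul_of_nonneg_left (pow_le_pow_left₀ hε.le hout.1.le _) hG).trans hmono
    have hcs := cs_pos κ (rdist κ x₀ x)
    have hd0 := deriv_smoothTransition_nonneg (sn κ (rdist κ x₀ x) / ε - 1)
    have hd := hC₃ (sn κ (rdist κ x₀ x) / ε - 1)
    have hk := (le_abs_self _).trans ((hC₁ x hxs).trans (le_abs_self _))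
    have hr := radDeriv_sq_le hκ ha (hΩM hx) hne u
    -- The factor `1/ε` is the slope of the cutoff, the other the growth of `vH`.
    have hpow : ε ^ 2 / ε ^ n = (1 / ε) * (1 / ε ^ (n - 3)) := by
      obtain ⟨m, rfl⟩ := Nat.exists_eq_add_of_le hn3
      simp only [Nat.add_sub_cancel_left, pow_add]
      field_simp
    rw [deriv_cutoff, hpow]
    set G := v (rdist κ x₀ x) * H (rdist κ x₀ x)
    set D := deriv Real.smoothTransition (sn κ (rdist κ x₀ x) / ε - 1)
    set g := tangentNorm κ x (grad κ u x) ^ 2 with hg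
    have hg0 : 0 ≤ g := sq_nonneg _
    -- Here `2u_ρ² - |∇u|² ≤ |∇u|²`, as `u_ρ² ≤ |∇u|²`.
    calc _ ≤ p κ x ^ n * (D * (cs κ (rdist κ x₀ x) / ε) * G) * g := by
          refine mul_le_mul_of_nonneg_left (by linarith) (by positivity)
      _ = (p κ x ^ n * cs κ (rdist κ x₀ x) * g) * D * G * (1 / ε) := by ring
      _ ≤ |C₁| * C₃ * (C₂ / ε ^ (n - 3)) * (1 / ε) := by gcongr
      _ = _ := by ring

end Main

/-! ### The pointwise inequality, its integration, and the limit. -/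

theorem setLIntegral_vol (hκ : 0 ≤ κ) {Ω : Set (E n)} (hΩ : IsOpen Ω) (hΩM : Ω ⊆ carrier n κ)
    (f : E n → ℝ) :
    ∫⁻ x in Ω, ENNReal.ofReal (f x) ∂(vol n κ) = ∫⁻ x in Ω, ENNReal.ofReal (p κ x ^ n * f x) := by
  have hpm : Measurable (p κ : E n → ℝ) := by
    unfold p; split_ifs <;> fun_prop
  rw [vol, setLIntegral_withDensity_eq_setLIntegral_mul_non_measurable _ (by fun_prop) _
    hΩ.measurableSet (by simp), Measure.restrict_restrict hΩ.measurableSet,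
    inter_eq_self_of_subset_left hΩM]
  refine setLIntegral_congr_fun hΩ.measurableSet fun x hx => ?_
  simp only [Pi.mul_apply]
  rw [ENNReal.ofReal_mul (pow_nonneg (p_pos hκ (hΩM hx)).le n)]

section Main

variable {Ω : Set (E n)} {x₀ : E n} {v V H : ℝ → ℝ} {u : E n → ℝ}

theorem eventually_cutoff_eq_zero (hκ : 0 ≤ κ) {a : E n} (ha : a ∈ carrier n κ) {ε : ℝ}
    (hε : 0 < ε) : ∀ᶠ y in 𝓝 a, cutoff κ ε (rdist κ a y) = 0 := by
  have h1 : ContinuousAt (fun y => sn κ (rdist κ a y)) a :=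
    (contDiff_sn κ).continuous.continuousAt.comp (continuousAt_rdist hκ ha ha)
  have h2 : sn κ (rdist κ a a) < ε := by
    rw [rdist_self hκ ha]; simpa [sn] using hε
  filter_upwards [h1.eventually_lt continuousAt_const h2] with y hy
  exact cutoff_eq_zero hε hy.le

theorem contDiff_pohozaevField_cutoff (hκ : 0 ≤ κ) (hΩ : IsOpen Ω) (hΩM : Ω ⊆ carrier n κ)
    (hx₀ : x₀ ∈ Ω) (hH : IsDualAdmissible κ Ω x₀ v V H) (hu : IsTestFunction Ω u) {ε : ℝ}
    (hε : 0 < ε) :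
    ContDiff ℝ 1 (pohozaevField κ x₀ (fun t => cutoff κ ε t * (v t * H t)) u) ∧
    HasCompactSupport (pohozaevField κ x₀ (fun t => cutoff κ ε t * (v t * H t)) u) := by
  have ha := hΩM hx₀
  refine ⟨contDiff_iff_contDiffAt.2 fun x => ?_, HasCompactSupport.intro hu.hasCompactSupport
    fun x hx => ?_⟩
  · by_cases hxa : x = x₀
    · subst hxa
      refine ContDiffAt.congr_of_eventuallyEq (f := fun _ => (0 : E n)) contDiffAt_const ?_
      filter_upwards [eventually_cutoff_eq_zero hκ ha hε] with y hy
      simp [pohozaevField, hy]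
    by_cases hx : x ∈ tsupport u
    · have hxΩ := hu.tsupport_subset hx
      have hxM := hΩM hxΩ
      have hxI := rdist_mem_radialInterval hκ hΩ hΩM hx₀ hxΩ hxa
      have hnhds := (isOpen_radialInterval κ Ω x₀).mem_nhds hxI
      have hρ := contDiffAt_rdist hκ ha hxM hxa
      have hN := (contDiff_gradient hu.smooth).contDiffAt (x := x)
      have hW := (contDiff_field κ x₀).contDiffAt (x := x)
      have hP := contDiffAt_p_zpow hκ hxM ((n : ℤ) - 2)
      have hG : ContDiffAt ℝ ∞ (fun t => cutoff κ ε t * (v t * H t)) (rdist κ x₀ x) :=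
        (contDiff_cutoff κ ε).contDiffAt.mul
          ((hH.smooth_v.contDiffAt hnhds).mul (hH.smooth_H.contDiffAt hnhds))
      have hφ : ContDiffAt ℝ ∞ (fun y => (fun t => cutoff κ ε t * (v t * H t)) (rdist κ x₀ y) /
          sn κ (rdist κ x₀ y)) x :=
        (ContDiffAt.comp x hG hρ).div (ContDiffAt.comp x (contDiff_sn κ).contDiffAt hρ)
          (sn_pos hκ hxI.1).ne'
      refine ContDiffAt.of_le (n := ∞) ?_ (by simp)
      exact ((hφ.mul (contDiffAt_const.mul (hN.inner ℝ hW))).smul (hP.smul hN)).sub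
        ((hφ.mul (hP.mul (hN.norm_sq ℝ))).smul hW)
    · refine ContDiffAt.congr_of_eventuallyEq (f := fun _ => (0 : E n)) contDiffAt_const ?_
      filter_upwards [gradient_eventuallyEq_zero hx] with y hy
      simp [pohozaevField, hy]
  · have hg := (gradient_eventuallyEq_zero hx).eq_of_nhds
    simp only [Pi.zero_apply] at hg
    simp [pohozaevField, hg]

/-- This is the completed square combined with the identity for the field of `χ vH`; the last term
comes from differentiating `χ`. Keeping `T` abstract lets both inequalities share the integration.
-/
theorem cutoff_integrand_le (hκ : 0 ≤ κ) (hΩ : IsOpen Ω) (hΩM : Ω ⊆ carrier n κ)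
    (hx₀ : x₀ ∈ Ω) (hH : IsDualAdmissible κ Ω x₀ v V H) (hu : IsTestFunction Ω u) {ε : ℝ}
    {x : E n} (hx : x ∈ Ω) (hne : x ≠ x₀) {T : ℝ}
    (hT : T ≤ E₁ n κ v H (rdist κ x₀ x) *
        (tangentNorm κ x (grad κ u x) ^ 2 - radDeriv κ x₀ u x ^ 2) +
      v (rdist κ x₀ x) * V (rdist κ x₀ x) * radDeriv κ x₀ u x ^ 2) :
    cutoff κ ε (rdist κ x₀ x) * (p κ x ^ n * T) ≤
      cutoff κ ε (rdist κ x₀ x) * (p κ x ^ n * (v (rdist κ x₀ x) * laplacian κ u x ^ 2)) -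
      euclDiv (pohozaevField κ x₀ (fun t => cutoff κ ε t * (v t * H t)) u) x +
      p κ x ^ n * (deriv (cutoff κ ε) (rdist κ x₀ x) * (v (rdist κ x₀ x) * H (rdist κ x₀ x))) *
        (2 * radDeriv κ x₀ u x ^ 2 - tangentNorm κ x (grad κ u x) ^ 2) := by
  have ha := hΩM hx₀
  have hxM := hΩM hx
  have hxI := rdist_mem_radialInterval hκ hΩ hΩM hx₀ hx hne
  have hp := p_pos hκ hxM
  have hχ : HasDerivAt (cutoff κ ε) (deriv (cutoff κ ε) (rdist κ x₀ x)) (rdist κ x₀ x) :=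
    ((contDiff_cutoff κ ε).differentiable (by simp) _).hasDerivAt
  have hG0 := hH.hasDerivAt_mul hxI
  have hG := hχ.fun_mul hG0
  rw [← hG0.deriv] at hG
  have hG' : deriv (fun t => cutoff κ ε t * (v t * H t)) (rdist κ x₀ x) = _ := hG.deriv
  rw [euclDiv_pohozaevField hκ ha hxM hne hu.smooth hG.differentiableAt, hG']
  have h1 := hH.mul_le hxI
  have hv := hH.nonneg_v _ hxI
  have hc := cutoff_nonneg κ ε (rdist κ x₀ x)
  unfold E₁ at hT
  unfold L at h1 hT
  generalize rdist κ x₀ x = t at *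
  generalize radDeriv κ x₀ u x = r at *
  generalize tangentNorm κ x (grad κ u x) ^ 2 = g at *
  generalize laplacian κ u x = Δ at *
  generalize deriv (fun s => v s * H s) t = G' at *
  generalize deriv (cutoff κ ε) t = χ' at *
  generalize cutoff κ ε t = χ at *
  generalize p κ x = q at *
  have h2 := mul_le_mul_of_nonneg_right h1 (sq_nonneg r)
  -- The square `v(Δu - H u_ρ)² ≥ 0`, the only estimate besides Riccati and the assumed bound on
  -- `T`.
  have h3 := mul_nonneg hv (sq_nonneg (Δ - H t * r))
  have h4 : 0 ≤ v t * Δ ^ 2 - 2 * (v t * H t) * r * Δ - 2 * (G' - ct κ t * (v t * H t)) * r ^ 2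
      + (G' + ((n : ℝ) - 3) * ct κ t * (v t * H t)) * g - T := by
    linarith
  have h5 := mul_nonneg (mul_nonneg hc (pow_nonneg hp.le n)) h4
  linarith

/-- The Rellich inequality for any integrand dominated by the pointwise lower bound. -/
theorem setLIntegral_le_laplacian (hκ : 0 ≤ κ) (hn : 1 ≤ n) (hΩ : IsOpen Ω)
    (hΩM : Ω ⊆ carrier n κ) (hx₀ : x₀ ∈ Ω) (hH : IsDualAdmissible κ Ω x₀ v V H)
    (h1 : ∀ t ∈ radialInterval κ Ω x₀, 0 ≤ E₁ n κ v H t) (hu : IsTestFunction Ω u)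
    {T : E n → ℝ} (hT0 : ∀ x ∈ Ω, x ≠ x₀ → 0 ≤ T x)
    (hTc : ∀ x ∈ Ω, x ≠ x₀ → ContinuousAt T x) (hTs : ∀ x ∉ tsupport u, T x = 0)
    (hT : ∀ x ∈ Ω, x ≠ x₀ → T x ≤ E₁ n κ v H (rdist κ x₀ x) *
        (tangentNorm κ x (grad κ u x) ^ 2 - radDeriv κ x₀ u x ^ 2) +
      v (rdist κ x₀ x) * V (rdist κ x₀ x) * radDeriv κ x₀ u x ^ 2) :
    ∫⁻ x in Ω, ENNReal.ofReal (T x) ∂(vol n κ) ≤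
      ∫⁻ x in Ω, ENNReal.ofReal (v (rdist κ x₀ x) * laplacian κ u x ^ 2) ∂(vol n κ) := by
  have := nontrivial_E hn
  have ha := hΩM hx₀
  have hI : ∀ x ∈ Ω, x ≠ x₀ → rdist κ x₀ x ∈ radialInterval κ Ω x₀ := fun x hx hne =>
    rdist_mem_radialInterval hκ hΩ hΩM hx₀ hx hne
  rw [setLIntegral_vol hκ hΩ hΩM, setLIntegral_vol hκ hΩ hΩM]
  obtain ⟨C, hC, c, hc, ε₀, hε₀, hflux⟩ := exists_flux_le hκ hn hΩ hΩM hx₀ hH h1 hu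
  set A : ℝ → E n → ℝ := fun ε x => cutoff κ ε (rdist κ x₀ x) * (p κ x ^ n * T x) with hA
  set B : ℝ → E n → ℝ := fun ε x => cutoff κ ε (rdist κ x₀ x) *
    (p κ x ^ n * (v (rdist κ x₀ x) * laplacian κ u x ^ 2)) with hB
  have hχc : ∀ ε, ∀ x ∈ Ω, ContinuousAt (fun x => cutoff κ ε (rdist κ x₀ x)) x := fun ε x hx =>
    (contDiff_cutoff κ ε).continuous.continuousAt.comp (continuousAt_rdist hκ ha (hΩM hx))
  have hAc : ∀ ε > 0, Continuous (A ε) ∧ HasCompactSupport (A ε) := by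
    intro ε hε
    refine continuous_of_continuousAt_off_point (a := x₀) hu.hasCompactSupport hu.tsupport_subset
      (fun x hx => by simp [hA, hTs x hx]) ?_ (fun x hx hne => ?_)
    · filter_upwards [eventually_cutoff_eq_zero hκ ha hε] with y hy
      simp [hA, hy]
    · exact (hχc ε x hx).mul (((continuousAt_p (hΩM hx)).pow n).mul (hTc x hx hne))
  have hBc : ∀ ε > 0, Continuous (B ε) ∧ HasCompactSupport (B ε) := by
    intro ε hε
    refine continuous_of_continuousAt_off_point (a := x₀) hu.hasCompactSupport hu.tsupport_subset
      (fun x hx => by simp [hB, laplacian_eq_zero hx]) ?_ (fun x hx hne => ?_)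
    · filter_upwards [eventually_cutoff_eq_zero hκ ha hε] with y hy
      simp [hB, hy]
    · have hv : ContinuousAt v (rdist κ x₀ x) := (hH.hasDerivAt_v (hI x hx hne)).continuousAt
      have hv2 : ContinuousAt (fun y => v (rdist κ x₀ y)) x :=
        ContinuousAt.comp (f := rdist κ x₀) hv (continuousAt_rdist hκ ha (hΩM hx))
      exact (hχc ε x hx).mul (((continuousAt_p (hΩM hx)).pow n).mul
        (hv2.mul ((continuousAt_laplacian hκ (hΩM hx) hu.smooth).pow 2)))
  have hcut0 : ∀ ε > 0, cutoff κ ε (rdist κ x₀ x₀) = 0 := fun ε hε =>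
    (eventually_cutoff_eq_zero hκ ha hε).self_of_nhds
  have hA0 : ∀ ε > 0, ∀ x, 0 ≤ A ε x := by
    intro ε hε x
    by_cases hx : x ∈ tsupport u
    · by_cases hne : x = x₀
      · subst hne; simp [hA, hcut0 ε hε]
      · have hxΩ := hu.tsupport_subset hx
        exact mul_nonneg (cutoff_nonneg _ _ _)
          (mul_nonneg (pow_nonneg (p_pos hκ (hΩM hxΩ)).le n) (hT0 x hxΩ hne))
    · simp [hA, hTs x hx]
  have hB0 : ∀ ε > 0, ∀ x, 0 ≤ B ε x := by
    intro ε hε x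
    by_cases hx : x ∈ tsupport u
    · by_cases hne : x = x₀
      · subst hne; simp [hB, hcut0 ε hε]
      · have hxΩ := hu.tsupport_subset hx
        exact mul_nonneg (cutoff_nonneg _ _ _)
          (mul_nonneg (pow_nonneg (p_pos hκ (hΩM hxΩ)).le n)
            (mul_nonneg (hH.nonneg_v _ (hI x hxΩ hne)) (sq_nonneg _)))
    · simp [hB, laplacian_eq_zero hx]
  set vb := (volume (Metric.ball (0 : E n) 1)).toReal with hvb
  -- The ball of radius `cε` has volume `vb (cε)^n`, which absorbs the `ε^(-n)` of the flux bound
  -- and leaves `ε²`.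
  have hint : ∀ ε, 0 < ε → ε < ε₀ → ∫ x, A ε x ≤ (∫ x, B ε x) + C * c ^ n * vb * ε ^ 2 := by
    intro ε hε hεε₀
    obtain ⟨hF, hFc⟩ := contDiff_pohozaevField_cutoff hκ hΩ hΩM hx₀ hH hu hε
    obtain ⟨hDi, hD0⟩ := integral_euclDiv_eq_zero hF hFc
    set F := pohozaevField κ x₀ (fun t => cutoff κ ε t * (v t * H t)) u with hFdef
    have hAi := (hAc ε hε).1.integrable_of_hasCompactSupport (μ := volume) (hAc ε hε).2
    have hBi := (hBc ε hε).1.integrable_of_hasCompactSupport (μ := volume) (hBc ε hε).2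
    have hball : volume (Metric.closedBall x₀ (c * ε)) ≠ ⊤ := measure_closedBall_lt_top.ne
    have hRi : Integrable ((Metric.closedBall x₀ (c * ε)).indicator
        (fun _ => C * (ε ^ 2 / ε ^ n))) :=
      (integrable_indicator_iff Metric.isClosed_closedBall.measurableSet).2
        (integrableOn_const hball)
    have hle : ∀ x, A ε x ≤ B ε x - euclDiv F x + (Metric.closedBall x₀ (c * ε)).indicator
        (fun _ => C * (ε ^ 2 / ε ^ n)) x := by
      intro x
      have hR0 : 0 ≤ (Metric.closedBall x₀ (c * ε)).indicator
          (fun _ => C * (ε ^ 2 / ε ^ n)) x :=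
        indicator_nonneg (fun _ _ => by positivity) x
      have hzero : F =ᶠ[𝓝 x] (fun _ => 0) → euclDiv F x = 0 := fun h => by
        simp [euclDiv, h.fderiv_eq]
      by_cases hx : x ∈ tsupport u
      · by_cases hne : x = x₀
        · subst hne
          have h0 : euclDiv F x = 0 := hzero (by
            filter_upwards [eventually_cutoff_eq_zero hκ ha hε] with y hy
            simp [hFdef, pohozaevField, hy])
          simp only [hA, hB, hcut0 ε hε, h0]
          simpa using hR0
        · have hxΩ := hu.tsupport_subset hx
          exact (cutoff_integrand_le hκ hΩ hΩM hx₀ hH hu hxΩ hne (hT x hxΩ hne)).trans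
            (by gcongr; exact hflux ε hε hεε₀ x hxΩ hne)
      · have h0 : euclDiv F x = 0 := hzero (by
          filter_upwards [gradient_eventuallyEq_zero hx] with y hy
          simp [hFdef, pohozaevField, hy])
        simp only [hA, hB, hTs x hx, laplacian_eq_zero hx, h0]
        simpa using hR0
    have hmono := integral_mono hAi ((hBi.sub hDi).add hRi) hle
    refine hmono.trans (le_of_eq ?_)
    have e1 : ∫ x, (((B ε - euclDiv F) + (Metric.closedBall x₀ (c * ε)).indicator
        (fun _ => C * (ε ^ 2 / ε ^ n))) x) = (∫ x, B ε x) - (∫ x, euclDiv F x) +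
        ∫ x, (Metric.closedBall x₀ (c * ε)).indicator (fun _ => C * (ε ^ 2 / ε ^ n)) x := by
      simp only [Pi.add_apply, Pi.sub_apply]
      have e2 := integral_add (hBi.sub hDi) hRi
      simp only [Pi.sub_apply] at e2
      rw [e2, integral_sub hBi hDi]
    rw [e1, hD0, sub_zero, integral_indicator Metric.isClosed_closedBall.measurableSet,
      setIntegral_const, Measure.real, Measure.addHaar_closedBall _ _ (by positivity),
      ENNReal.toReal_mul, ENNReal.toReal_ofReal (by positivity), finrank_euclideanSpace_fin,
      smul_eq_mul, ← hvb, mul_pow]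
    field_simp
  have hbound : ∀ ε, 0 < ε → ε < ε₀ → ∫⁻ x in Ω, ENNReal.ofReal (A ε x) ≤
      (∫⁻ x in Ω, ENNReal.ofReal (p κ x ^ n * (v (rdist κ x₀ x) * laplacian κ u x ^ 2))) +
        ENNReal.ofReal (C * c ^ n * vb * ε ^ 2) := by
    intro ε hε hεε₀
    have hAi := (hAc ε hε).1.integrable_of_hasCompactSupport (μ := volume) (hAc ε hε).2
    have hBi := (hBc ε hε).1.integrable_of_hasCompactSupport (μ := volume) (hBc ε hε).2
    calc ∫⁻ x in Ω, ENNReal.ofReal (A ε x) ≤ ∫⁻ x, ENNReal.ofReal (A ε x) :=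
          setLIntegral_le_lintegral _ _
      _ = ENNReal.ofReal (∫ x, A ε x) :=
          (ofReal_integral_eq_lintegral_ofReal hAi (Filter.Eventually.of_forall (hA0 ε hε))).symm
      _ ≤ ENNReal.ofReal ((∫ x, B ε x) + C * c ^ n * vb * ε ^ 2) :=
          ENNReal.ofReal_le_ofReal (hint ε hε hεε₀)
      _ ≤ ENNReal.ofReal (∫ x, B ε x) + ENNReal.ofReal (C * c ^ n * vb * ε ^ 2) :=
          ENNReal.ofReal_add_le
      _ = (∫⁻ x, ENNReal.ofReal (B ε x)) + ENNReal.ofReal (C * c ^ n * vb * ε ^ 2) := by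
          rw [ofReal_integral_eq_lintegral_ofReal hBi (Filter.Eventually.of_forall (hB0 ε hε))]
      _ ≤ _ := by
          refine add_le_add ?_ le_rfl
          rw [← lintegral_indicator hΩ.measurableSet]
          refine lintegral_mono fun x => ?_
          by_cases hx : x ∈ tsupport u
          · have hxΩ := hu.tsupport_subset hx
            rw [indicator_of_mem hxΩ]
            by_cases hne : x = x₀
            · subst hne; simp [hB, hcut0 ε hε]
            · exact ENNReal.ofReal_le_ofReal (mul_le_of_le_one_left
                (mul_nonneg (pow_nonneg (p_pos hκ (hΩM hxΩ)).le n)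
                  (mul_nonneg (hH.nonneg_v _ (hI x hxΩ hne)) (sq_nonneg _)))
                (cutoff_le_one _ _ _))
          · simp [hB, laplacian_eq_zero hx]
  -- The shift by `2` keeps every term strictly below `ε₀`.
  set e : ℕ → ℝ := fun k => ε₀ / (k + 2) with he
  have he0 : ∀ k, 0 < e k := fun k => by positivity
  have heε₀ : ∀ k, e k < ε₀ := fun k => div_lt_self hε₀ (by
    have : (0 : ℝ) ≤ k := k.cast_nonneg
    linarith)
  have het : Filter.Tendsto e Filter.atTop (𝓝 0) :=
    Filter.Tendsto.div_atTop tendsto_const_nhds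
      (Filter.tendsto_atTop_add_const_right _ _ tendsto_natCast_atTop_atTop)
  have hlim : ∀ x ∈ Ω, x ≠ x₀ →
      Filter.liminf (fun k => ENNReal.ofReal (A (e k) x)) Filter.atTop =
        ENNReal.ofReal (p κ x ^ n * T x) := by
    intro x hx hne
    refine Filter.Tendsto.liminf_eq (tendsto_const_nhds.congr' ?_)
    have hs := sn_pos hκ (hI x hx hne).1
    filter_upwards [het.eventually_lt_const (half_pos hs)] with k hk
    simp only [hA]
    rw [cutoff_eq_one (he0 k) (by linarith), one_mul]
  -- Fatou's lemma: neither side is known to be finite, and off the centre the cutoff is eventually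
  -- `1`.
  calc ∫⁻ x in Ω, ENNReal.ofReal (p κ x ^ n * T x)
      = ∫⁻ x in Ω, Filter.liminf (fun k => ENNReal.ofReal (A (e k) x)) Filter.atTop := by
        refine lintegral_congr_ae ?_
        have h0 : ∀ᵐ x ∂(volume.restrict Ω), x ≠ x₀ := by
          refine ae_restrict_of_ae ?_
          simp [ae_iff]
        filter_upwards [ae_restrict_mem hΩ.measurableSet, h0] with x hx hne
        exact (hlim x hx hne).symm
    _ ≤ Filter.liminf (fun k => ∫⁻ x in Ω, ENNReal.ofReal (A (e k) x)) Filter.atTop :=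
        lintegral_liminf_le fun k => (hAc (e k) (he0 k)).1.measurable.ennreal_ofReal
    _ ≤ Filter.liminf (fun k =>
        (∫⁻ x in Ω, ENNReal.ofReal (p κ x ^ n * (v (rdist κ x₀ x) * laplacian κ u x ^ 2))) +
          ENNReal.ofReal (C * c ^ n * vb * e k ^ 2)) Filter.atTop :=
        Filter.liminf_le_liminf (Filter.Eventually.of_forall fun k =>
          hbound (e k) (he0 k) (heε₀ k))
    _ = _ := by
        refine Filter.Tendsto.liminf_eq ?_
        have h2 : Filter.Tendsto (fun k => ENNReal.ofReal (C * c ^ n * vb * e k ^ 2)) Filter.atTop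
            (𝓝 0) := by
          have h3 := ENNReal.tendsto_ofReal ((het.pow 2).const_mul (C * c ^ n * vb))
          simpa using h3
        simpa using (tendsto_const_nhds (x := ∫⁻ x in Ω, ENNReal.ofReal
          (p κ x ^ n * (v (rdist κ x₀ x) * laplacian κ u x ^ 2)))).add h2

end Main

end SpaceForm

end


/-! ### The two Rellich inequalities. -/

theorem theorem3p1 (n : ℕ) (κ : ℝ) (hκ : 0 ≤ κ)
    (Ω : Set (SpaceForm.E n)) (hΩ : IsOpen Ω) (hΩM : Ω ⊆ SpaceForm.carrier n κ)
    (x₀ : SpaceForm.E n) (hx₀ : x₀ ∈ Ω) (v V H : ℝ → ℝ)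
    (hH : SpaceForm.IsDualAdmissible κ Ω x₀ v V H) :
    ((∀ t ∈ SpaceForm.radialInterval κ Ω x₀, 0 ≤ SpaceForm.E₁ n κ v H t) →
      ∀ u : SpaceForm.E n → ℝ, SpaceForm.IsTestFunction Ω u →
        ∫⁻ x in Ω, ENNReal.ofReal (v (SpaceForm.rdist κ x₀ x) * V (SpaceForm.rdist κ x₀ x) *
            SpaceForm.radDeriv κ x₀ u x ^ 2) ∂(SpaceForm.vol n κ) ≤
          ∫⁻ x in Ω, ENNReal.ofReal (v (SpaceForm.rdist κ x₀ x) *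
            SpaceForm.laplacian κ u x ^ 2) ∂(SpaceForm.vol n κ)) ∧
    ((∀ t ∈ SpaceForm.radialInterval κ Ω x₀, 0 ≤ SpaceForm.E₂ κ v H t) →
      ∀ u : SpaceForm.E n → ℝ, SpaceForm.IsTestFunction Ω u →
        ∫⁻ x in Ω, ENNReal.ofReal (v (SpaceForm.rdist κ x₀ x) * V (SpaceForm.rdist κ x₀ x) *
            SpaceForm.tangentNorm κ x (SpaceForm.grad κ u x) ^ 2) ∂(SpaceForm.vol n κ) ≤
          ∫⁻ x in Ω, ENNReal.ofReal (v (SpaceForm.rdist κ x₀ x) *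
            SpaceForm.laplacian κ u x ^ 2) ∂(SpaceForm.vol n κ)) := by
  have ha := hΩM hx₀
  have hI : ∀ x ∈ Ω, x ≠ x₀ → SpaceForm.rdist κ x₀ x ∈ SpaceForm.radialInterval κ Ω x₀ :=
    fun x hx hne => SpaceForm.rdist_mem_radialInterval hκ hΩ hΩM hx₀ hx hne
  have hvV : ∀ x ∈ Ω, x ≠ x₀ →
      0 ≤ v (SpaceForm.rdist κ x₀ x) * V (SpaceForm.rdist κ x₀ x) := fun x hx hne =>
    mul_nonneg (hH.nonneg_v _ (hI x hx hne)) (hH.nonneg_V _ (hI x hx hne))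
  have hvVc : ∀ x ∈ Ω, x ≠ x₀ → ContinuousAt
      (fun y => v (SpaceForm.rdist κ x₀ y) * V (SpaceForm.rdist κ x₀ y)) x := by
    intro x hx hne
    have hnhds := (SpaceForm.isOpen_radialInterval κ Ω x₀).mem_nhds (hI x hx hne)
    have hρ := SpaceForm.continuousAt_rdist hκ ha (hΩM hx)
    exact (ContinuousAt.comp (f := SpaceForm.rdist κ x₀)
        (hH.smooth_v.contDiffAt hnhds).continuousAt hρ).mul
      (ContinuousAt.comp (f := SpaceForm.rdist κ x₀)
        (hH.smooth_V.contDiffAt hnhds).continuousAt hρ)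
  -- In dimension zero every gradient vanishes, so both left sides are `0`.
  rcases Nat.eq_zero_or_pos n with rfl | hn
  · have hg : ∀ (u : SpaceForm.E 0 → ℝ) x, gradient u x = 0 := fun u x => Subsingleton.elim _ _
    refine ⟨fun _ u _ => ?_, fun _ u _ => ?_⟩
    · simp [SpaceForm.radDeriv_eq_zero, hg]
    · simp [SpaceForm.tangentNorm_grad_eq_zero, hg]
  refine ⟨fun h1 u hu => ?_, fun h2 u hu => ?_⟩
  · refine SpaceForm.setLIntegral_le_laplacian hκ hn hΩ hΩM hx₀ hH h1 hu
      (fun x hx hne => mul_nonneg (hvV x hx hne) (sq_nonneg _))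
      (fun x hx hne => (hvVc x hx hne).mul
        ((SpaceForm.continuousAt_radDeriv hκ ha (hΩM hx) hne hu.smooth).pow 2))
      (fun x hx => ?_) (fun x hx hne => ?_)
    · rw [SpaceForm.radDeriv_eq_zero _ (SpaceForm.gradient_eventuallyEq_zero hx).eq_of_nhds]
      simp
    · exact le_add_of_nonneg_left (mul_nonneg (h1 _ (hI x hx hne))
        (sub_nonneg.2 (SpaceForm.radDeriv_sq_le hκ ha (hΩM hx) hne u)))
  -- Since `vV ≥ 0`, this bound also supplies `E₁ ≥ 0`, which the flux estimate needs.
  · have hE : ∀ t ∈ SpaceForm.radialInterval κ Ω x₀, v t * V t ≤ SpaceForm.E₁ n κ v H t :=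
      fun t ht => hH.mul_le_E₁ ht (h2 t ht)
    refine SpaceForm.setLIntegral_le_laplacian hκ hn hΩ hΩM hx₀ hH
      (fun t ht => (mul_nonneg (hH.nonneg_v t ht) (hH.nonneg_V t ht)).trans (hE t ht)) hu
      (fun x hx hne => mul_nonneg (hvV x hx hne) (sq_nonneg _))
      (fun x hx hne => (hvVc x hx hne).mul
        (SpaceForm.continuousAt_tangentNorm_grad_sq hκ (hΩM hx) hu.smooth))
      (fun x hx => ?_) (fun x hx hne => ?_)
    · rw [SpaceForm.tangentNorm_grad_eq_zero (SpaceForm.gradient_eventuallyEq_zero hx).eq_of_nhds]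
      simp
    · have hr := SpaceForm.radDeriv_sq_le hκ ha (hΩM hx) hne u
      -- Replacing `E₁` by `vV` in front of `|∇u|² - u_ρ²` turns the lower bound into `vV|∇u|²`.
      have := mul_le_mul_of_nonneg_right (hE _ (hI x hx hne)) (sub_nonneg.2 hr)
      linarith
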